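/- Let $n\ge 2$ and $[n]=\{1,\dots,n\}$. Fix vectors $\xi_1,\dots,\xi_n$ of the same length in the open upper half-plane, going in this order clockwise around the origin, and let $Z=\{\sum_i a_i\xi_i : 0\le a_i\le 1\}$ be the zonogon they generate. A tile is a translate of the rhombus $[0,\xi_i]+[0,\xi_j]$, $1\le i<j\le n$. A (rhombus) tiling $T$ of $Z$ is a finite set of tiles whose union is $Z$ and such that any two distinct tiles that intersect do so in a single common vertex or a single common closed edge. The edges of the tiles are directed upward, and an edge parallel to $\xi_i$ has color $i$. A snake of $T$ is a directed path along edges of tiles of $T$ from the bottom vertex $0$ of $Z$ to the top vertex $\xi_1+\dots+\xi_n$. A linear order $\sigma$ on $[n]$, with $x_1<_\sigma\dots<_\sigma x_n$, occurs in $T$ if $x_1,\dots,x_n$ is the sequence of edge colors of a snake of $T$. For a linear order $\sigma$ on $[n]$ let $Id(\sigma)$ be the set of its ideals, i.e. of the sets $X\subseteq[n]$ (including $\emptyset$) such that $x\in X$ and $y<_\sigma x$ imply $y\in X$. Let $Inv(\sigma)=\{(i,j): i<j,\ j<_\sigma i\}$; the linear orders on $[n]$, ordered by inclusion of the sets $Inv(\cdot)$,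 form a lattice (the Bruhat lattice), with join $\vee$ and meet $\wedge$. Sets $A,B\subseteq[n]$ are separated if the minimal intervals containing $A\setminus B$ and $B\setminus A$ are disjoint, and a set system is separated if any two of its members are. For $i<j<k$ in $[n]$, $\sigma$ satisfies the peak condition on $ijk$ if its restriction to $\{i,j,k\}$, written from worst to best, is one of $ijk, ikj, kij, kji$ (so $j$ is not the worst), and the pit condition if it is one of $ijk, jik, jki, kji$ (so $j$ is not the best). Let $\sigma$ and $\tau$ be linear orders on $[n]$. The following are equivalent: (i) $\sigma$ and $\tau$ are strongly consistent, i.e. there is a tiling $T$ of $Z$ in which both occur; (ii) the set system $Id(\sigma)\cup Id(\tau)$ is separated; (iii) for each triple $i<j<k$ in $[n]$, either both $\sigma$ and $\tau$ satisfy the peak condition on $ijk$, or both satisfy the pit condition on $ijk$; (iv) $Id(\sigma)\cup Id(\tau)=Id(\sigma\vee\tau)\cup Id(\sigma\wedge\tau)$; (iv$'$) $Id(\sigma)\cup Id(\tau)\subseteq Id(\sigma\vee\tau)\cup Id(\sigma\wedge\tau)$. -/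

import Mathlib

/-! ### Linear orders on `[n]` and the weak Bruhat lattice -/

/-- A linear order on `[n]` (modelled by `Fin n`), given by its strict relation;
`σ.lt i j` is `i <_σ j`, that is, `i` is worse than `j`. -/
@[ext]
structure LinearOrderOn (n : ℕ) where
  lt : Fin n → Fin n → Prop
  irrefl : ∀ i, ¬ lt i i
  trans : ∀ i j k, lt i j → lt j k → lt i k
  total : ∀ i j, i ≠ j → lt i j ∨ lt j i

namespace LinearOrderOn

variable {n : ℕ}

theorem asymm (σ : LinearOrderOn n) {i j : Fin n} (h : σ.lt i j) : ¬ σ.lt j i :=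
  fun h' => σ.irrefl i (σ.trans i j i h h')

/-- The set of inversions: pairs `i < j` such that `j <_σ i`. -/
def Inv (σ : LinearOrderOn n) : Set (Fin n × Fin n) :=
  {p | p.1 < p.2 ∧ σ.lt p.2 p.1}

theorem eq_of_inv_eq {σ τ : LinearOrderOn n} (h : σ.Inv = τ.Inv) : σ = τ := by
  have key : ∀ i j : Fin n, i < j → (σ.lt j i ↔ τ.lt j i) := by
    intro i j hij
    have := Set.ext_iff.1 h (i, j)
    simpa [Inv, hij] using this
  have flip : ∀ (ρ : LinearOrderOn n) (i j : Fin n), i < j → (ρ.lt i j ↔ ¬ ρ.lt j i) := by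
    intro ρ i j hij
    exact ⟨fun h => ρ.asymm h, fun h => (ρ.total i j hij.ne).resolve_right h⟩
  ext i j
  rcases lt_trichotomy i j with hij | hij | hij
  · rw [flip σ i j hij, flip τ i j hij, key i j hij]
  · subst hij
    exact ⟨fun h => absurd h (σ.irrefl i), fun h => absurd h (τ.irrefl i)⟩
  · exact key j i hij

/-- The weak Bruhat order: `σ ≤ τ` if every inversion of `σ` is an inversion of `τ`. -/
instance : PartialOrder (LinearOrderOn n) where
  le σ τ := σ.Inv ⊆ τ.Inv
  le_refl _ := subset_rfl
  le_trans _ _ _ h h' := h.trans h'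
  le_antisymm _ _ h h' := eq_of_inv_eq (h.antisymm h')

theorem le_iff {σ τ : LinearOrderOn n} :
    σ ≤ τ ↔ ∀ i j : Fin n, i < j → σ.lt j i → τ.lt j i := by
  constructor
  · intro h i j hij hs
    exact (h (show (i, j) ∈ σ.Inv from ⟨hij, hs⟩)).2
  · rintro h ⟨i, j⟩ ⟨hij, hs⟩
    exact ⟨hij, h i j hij hs⟩

/-- The reversed order. -/
def rev (σ : LinearOrderOn n) : LinearOrderOn n where
  lt i j := σ.lt j i
  irrefl := σ.irrefl
  trans i j k h h' := σ.trans k j i h' h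
  total i j h := (σ.total i j h).symm

theorem rev_rev (σ : LinearOrderOn n) : σ.rev.rev = σ := rfl

theorem rev_le_rev {σ τ : LinearOrderOn n} (h : σ ≤ τ) : τ.rev ≤ σ.rev := by
  rw [le_iff] at h ⊢
  intro i j hij ht
  rcases σ.total i j hij.ne with h1 | h1
  · exact h1
  · exact absurd (h i j hij h1) (τ.asymm ht)

/-- The transitive closure of the union of the inversion sets of two linear orders. -/
def JoinInv (σ τ : LinearOrderOn n) : Fin n → Fin n → Prop :=
  Relation.TransGen fun i j => i < j ∧ (σ.lt j i ∨ τ.lt j i)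

theorem JoinInv.lt {σ τ : LinearOrderOn n} {i j : Fin n} (h : JoinInv σ τ i j) : i < j := by
  induction h with
  | single h => exact h.1
  | tail _ h ih => exact ih.trans h.1

theorem JoinInv.split {σ τ : LinearOrderOn n} {i k : Fin n} (h : JoinInv σ τ i k) :
    ∀ j, i < j → j < k → JoinInv σ τ i j ∨ JoinInv σ τ j k := by
  have step : ∀ a j b : Fin n, a < j → j < b → (σ.lt b a ∨ τ.lt b a) →
      JoinInv σ τ a j ∨ JoinInv σ τ j b := by
    intro a j b haj hjb hab
    rcases hab with hab | hab
    · rcases σ.total j a haj.ne' with h1 | h1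
      · exact Or.inl (Relation.TransGen.single ⟨haj, Or.inl h1⟩)
      · exact Or.inr (Relation.TransGen.single ⟨hjb, Or.inl (σ.trans b a j hab h1)⟩)
    · rcases τ.total j a haj.ne' with h1 | h1
      · exact Or.inl (Relation.TransGen.single ⟨haj, Or.inr h1⟩)
      · exact Or.inr (Relation.TransGen.single ⟨hjb, Or.inr (τ.trans b a j hab h1)⟩)
  induction h with
  | single h => intro j hij hjk; exact step _ j _ hij hjk h.2
  | @tail b c hb hbc ih =>
    intro j hij hjc
    rcases lt_trichotomy j b with hjb | hjb | hjb
    · rcases ih j hij hjb with h1 | h1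
      · exact Or.inl h1
      · exact Or.inr (Relation.TransGen.tail h1 hbc)
    · subst hjb
      exact Or.inl hb
    · rcases step b j c hjb hjc hbc.2 with h1 | h1
      · exact Or.inl (Relation.TransGen.trans hb h1)
      · exact Or.inr h1

/-- The linear order whose inversions are the pairs in `JoinInv σ τ`. -/
def join (σ τ : LinearOrderOn n) : LinearOrderOn n where
  lt i j := (i < j ∧ ¬ JoinInv σ τ i j) ∨ JoinInv σ τ j i
  irrefl i := by
    rintro (h | h)
    · exact lt_irrefl i h.1
    · exact lt_irrefl i h.lt
  trans i j k := by
    have tr : ∀ a b c, JoinInv σ τ a b → JoinInv σ τ b c → JoinInv σ τ a c :=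
      fun a b c h h' => Relation.TransGen.trans h h'
    rintro (⟨hij, h1⟩ | h1) (⟨hjk, h2⟩ | h2)
    · refine Or.inl ⟨hij.trans hjk, fun h => ?_⟩
      rcases h.split j hij hjk with h | h
      · exact h1 h
      · exact h2 h
    · rcases lt_trichotomy i k with hik | hik | hik
      · exact Or.inl ⟨hik, fun h => h1 (tr _ _ _ h h2)⟩
      · subst hik
        exact absurd h2 h1
      · exact Or.inr ((h2.split i hik hij).resolve_right h1)
    · rcases lt_trichotomy i k with hik | hik | hik
      · exact Or.inl ⟨hik, fun h => h2 (tr _ _ _ h1 h)⟩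
      · subst hik
        exact absurd h1 h2
      · exact Or.inr ((h1.split k hjk hik).resolve_left h2)
    · exact Or.inr (tr _ _ _ h2 h1)
  total i j hij := by
    by_cases h1 : JoinInv σ τ i j
    · exact Or.inr (Or.inr h1)
    by_cases h2 : JoinInv σ τ j i
    · exact Or.inl (Or.inr h2)
    rcases lt_or_gt_of_ne hij with h | h
    · exact Or.inl (Or.inl ⟨h, h1⟩)
    · exact Or.inr (Or.inl ⟨h, h2⟩)

theorem join_lt_iff {σ τ : LinearOrderOn n} {i j : Fin n} (hij : i < j) :
    (join σ τ).lt j i ↔ JoinInv σ τ i j :=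
  ⟨fun h => h.resolve_left fun h' => lt_asymm hij h'.1, Or.inr⟩

theorem le_join_left (σ τ : LinearOrderOn n) : σ ≤ join σ τ :=
  le_iff.2 fun _ _ hij h => (join_lt_iff hij).2 (Relation.TransGen.single ⟨hij, Or.inl h⟩)

theorem le_join_right (σ τ : LinearOrderOn n) : τ ≤ join σ τ :=
  le_iff.2 fun _ _ hij h => (join_lt_iff hij).2 (Relation.TransGen.single ⟨hij, Or.inr h⟩)

theorem join_le {σ τ ρ : LinearOrderOn n} (h1 : σ ≤ ρ) (h2 : τ ≤ ρ) : join σ τ ≤ ρ := by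
  rw [le_iff] at h1 h2 ⊢
  intro i j hij h
  rw [join_lt_iff hij] at h
  clear hij
  induction h with
  | single h => exact h.2.elim (h1 _ _ h.1) (h2 _ _ h.1)
  | tail _ h ih => exact ρ.trans _ _ _ (h.2.elim (h1 _ _ h.1) (h2 _ _ h.1)) ih

/-- The Bruhat lattice; `σ ⊔ τ` and `σ ⊓ τ` are its join and meet. -/
instance : Lattice (LinearOrderOn n) where
  sup := join
  le_sup_left := le_join_left
  le_sup_right := le_join_right
  sup_le _ _ _ := join_le
  inf σ τ := (join σ.rev τ.rev).rev
  inf_le_left σ τ := rev_le_rev (le_join_left σ.rev τ.rev)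
  inf_le_right σ τ := rev_le_rev (le_join_right σ.rev τ.rev)
  le_inf _ _ _ h1 h2 := rev_le_rev (join_le (rev_le_rev h1) (rev_le_rev h2))

/-! ### Ideals and the peak and pit conditions -/

/-- The set `Id(σ)` of ideals of `σ` (the empty set included). -/
def Id (σ : LinearOrderOn n) : Set (Set (Fin n)) :=
  {X | ∀ x ∈ X, ∀ y, σ.lt y x → y ∈ X}

/-- The restriction of `σ` to `{a, b, c}` is the order with word `abc`. -/
def Reads (σ : LinearOrderOn n) (a b c : Fin n) : Prop :=
  σ.lt a b ∧ σ.lt b c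

/-- The peak condition on the triple `i < j < k`: the restriction of `σ` is one of
`ijk`, `ikj`, `kij`, `kji` (so `j` is not the worst). -/
def Peak (σ : LinearOrderOn n) (i j k : Fin n) : Prop :=
  σ.Reads i j k ∨ σ.Reads i k j ∨ σ.Reads k i j ∨ σ.Reads k j i

/-- The pit condition on the triple `i < j < k`: the restriction of `σ` is one of
`ijk`, `jik`, `jki`, `kji` (so `j` is not the best). -/
def Pit (σ : LinearOrderOn n) (i j k : Fin n) : Prop :=
  σ.Reads i j k ∨ σ.Reads j i k ∨ σ.Reads j k i ∨ σ.Reads k j i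

end LinearOrderOn

/-! ### Separated set-systems -/

/-- The minimal interval of `[n]` containing `A` (empty if `A` is empty). -/
def intervalHull {n : ℕ} (A : Set (Fin n)) : Set (Fin n) :=
  {x | ∃ a ∈ A, ∃ b ∈ A, a ≤ x ∧ x ≤ b}

/-- `A` and `B` are (strongly) separated. -/
def Separated {n : ℕ} (A B : Set (Fin n)) : Prop :=
  Disjoint (intervalHull (A \ B)) (intervalHull (B \ A))

/-- A set-system is separated if any two of its members are. -/
def SeparatedSystem {n : ℕ} (X : Set (Set (Fin n))) : Prop :=
  ∀ A ∈ X, ∀ B ∈ X, Separated A B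

/-! ### Rhombus tilings of a zonogon -/

/-- Vectors `ξ_1, …, ξ_n` of the same length in the open upper half-plane, going in this
order clockwise around the origin. The plane is `ℂ`; for vectors of the upper half-plane,
`clockwise` (a negative determinant) says that `ξ j` is clockwise from `ξ i`. -/
structure IsZonogonFrame {n : ℕ} (ξ : Fin n → ℂ) : Prop where
  upper : ∀ i, 0 < (ξ i).im
  clockwise : ∀ i j, i < j → (ξ i).re * (ξ j).im - (ξ i).im * (ξ j).re < 0
  same_length : ∀ i j, ‖ξ i‖ = ‖ξ j‖

/-- The zonogon `Z`, the sum of the segments `[0, ξ_i]`. -/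
def zonogon {n : ℕ} (ξ : Fin n → ℂ) : Set ℂ :=
  {z | ∃ a : Fin n → ℝ, (∀ i, 0 ≤ a i ∧ a i ≤ 1) ∧ z = ∑ i, (a i : ℂ) * ξ i}

/-- An `ij`-tile (`i < j`), recorded by its colors and its bottom vertex. -/
structure Tile (n : ℕ) where
  base : ℂ
  i : Fin n
  j : Fin n
  hij : i < j

namespace Tile

variable {n : ℕ}

/-- The closed rhombus, a translate of `[0, ξ_i] + [0, ξ_j]`. -/
def carrier (ξ : Fin n → ℂ) (t : Tile n) : Set ℂ :=
  {z | ∃ a b : ℝ, (0 ≤ a ∧ a ≤ 1) ∧ (0 ≤ b ∧ b ≤ 1) ∧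
    z = t.base + (a : ℂ) * ξ t.i + (b : ℂ) * ξ t.j}

/-- `v` is one of the four vertices of the rhombus. -/
def IsVertex (ξ : Fin n → ℂ) (t : Tile n) (v : ℂ) : Prop :=
  v = t.base ∨ v = t.base + ξ t.i ∨ v = t.base + ξ t.j ∨ v = t.base + ξ t.i + ξ t.j

/-- The segment from `v` up to `v + ξ c` is one of the four edges of the rhombus. -/
def IsEdge (ξ : Fin n → ℂ) (t : Tile n) (v : ℂ) (c : Fin n) : Prop :=
  (c = t.i ∧ (v = t.base ∨ v = t.base + ξ t.j)) ∨
  (c = t.j ∧ (v = t.base ∨ v = t.base + ξ t.i))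

end Tile

/-- A rhombus tiling of the zonogon: finitely many tiles that cover it and of which any two
that intersect do so in a single common vertex or a single common closed edge. -/
structure RhombusTiling {n : ℕ} (ξ : Fin n → ℂ) where
  tiles : Finset (Tile n)
  cover : (⋃ t ∈ tiles, t.carrier ξ) = zonogon ξ
  inter : ∀ t ∈ tiles, ∀ t' ∈ tiles, t ≠ t' → (t.carrier ξ ∩ t'.carrier ξ).Nonempty →
    (∃ v, t.IsVertex ξ v ∧ t'.IsVertex ξ v ∧ t.carrier ξ ∩ t'.carrier ξ = {v}) ∨
    (∃ v c, t.IsEdge ξ v c ∧ t'.IsEdge ξ v c ∧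
      t.carrier ξ ∩ t'.carrier ξ = segment ℝ v (v + ξ c))

namespace RhombusTiling

variable {n : ℕ} {ξ : Fin n → ℂ}

/-- The edges of the graph `G_T`, directed upward: an edge of color `c` starts at `v`. -/
def IsEdge (T : RhombusTiling ξ) (v : ℂ) (c : Fin n) : Prop :=
  ∃ t ∈ T.tiles, t.IsEdge ξ v c

/-- There is a directed path in `G_T` from `u` to `v` with the given sequence of colors. -/
def IsPath (T : RhombusTiling ξ) : ℂ → List (Fin n) → ℂ → Prop
  | u, [], v => u = v
  | u, c :: l, v => T.IsEdge u c ∧ T.IsPath (u + ξ c) l v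

/-- The given sequence is the sequence of edge colors of a snake of `T`, that is, of a directed
path from the bottom vertex `0` of the zonogon to its top vertex. -/
def IsSnake (T : RhombusTiling ξ) (l : List (Fin n)) : Prop :=
  T.IsPath 0 l (∑ i, ξ i)

/-- The set `Σ(T)` of linear orders compatible with `T`: the sequence of colors along some
snake of `T` is the word of `σ`. -/
def compatible (T : RhombusTiling ξ) : Set (LinearOrderOn n) :=
  {σ | ∃ l, T.IsSnake l ∧ l.Pairwise σ.lt ∧ ∀ i, i ∈ l}

end RhombusTiling

/-- `σ` and `τ` are strongly consistent: some tiling is compatible with both. -/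
def StronglyConsistent {n : ℕ} (ξ : Fin n → ℂ) (σ τ : LinearOrderOn n) : Prop :=
  ∃ T : RhombusTiling ξ, σ ∈ T.compatible ∧ τ ∈ T.compatible

/-! A snake with color sequence σ uses the color c on the edge whose lower end is `foot`, the sum of
the ξ_x over x <_σ c. Hence whether σ occurs in a tiling is decided color by color (`HasSnake`),
through the lower sets {x | x <_σ c} alone.

Combinatorics: (iii) fails exactly when the middle of some triple is worst in one order and best in
the other (`Opposed`). The ideals cut off at that middle element then violate (ii) and (iv'), and
conversely two ideals that are not separated produce such a triple. Without opposed triples the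
orders are `LocallyNested`: no color lies both in a pair inverted by σ only and in a pair inverted
by τ only. Then the union and the intersection of the inversion sets are the inversion sets of σ ∨ τ
and σ ∧ τ, (iv) follows by excluding cycles, and each lower set {x | x <_σ c} is that of c in σ ∨ τ
or in σ ∧ τ (`LocallyNested.lower_eq`).

(iii) → (i): a chain of adjacent transpositions from 12…n to n…21 pushes a snake across the zonogon
from left to right, one rhombus at a time, and the rhombi swept form a tiling (`IsSweep.tiling`).
For a chain through σ ∧ τ and σ ∨ τ, every edge of the snakes of σ and τ is an edge of one of these
two snakes.

(i) → (iii): in any tiling, a snake other than the right boundary can be flipped to the right across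
a tile (`exists_flipIn`); with the central symmetry, the tiling is swept by a chain through any
given snake, so each tile lies before or after that snake. If j is worst in σ and best in τ on ijk,
take an ij-tile A and a jk-tile B: σ comes after A and before B, τ after B and before A. The edge of
color j only moves to the right during a sweep (`wedge_foot_mono`), which gives two incompatible
inequalities (`HasSnake.not_opposed`). -/

namespace LinearOrderOn

/-! ### Triples, separation, and the ideals of the join and the meet -/

variable {n : ℕ}

theorem not_lt_iff {σ : LinearOrderOn n} {i j : Fin n} (h : i ≠ j) : ¬ σ.lt i j ↔ σ.lt j i :=
  ⟨fun h' => (σ.total i j h).resolve_left h', fun h' => σ.asymm h'⟩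

theorem ne_of_lt {σ : LinearOrderOn n} {i j : Fin n} (h : σ.lt i j) : i ≠ j := by
  rintro rfl
  exact σ.irrefl i h

theorem peak_iff (σ : LinearOrderOn n) {i j k : Fin n} (hij : i < j) (hjk : j < k) :
    σ.Peak i j k ↔ ¬ (σ.lt j i ∧ σ.lt j k) := by
  have h1 := σ.total i j hij.ne
  have h2 := σ.total j k hjk.ne
  have h3 := σ.total i k (hij.trans hjk).ne
  have a1 := σ.asymm (i := i) (j := j)
  have a2 := σ.asymm (i := j) (j := k)
  have a3 := σ.asymm (i := i) (j := k)
  have t1 := σ.trans i k j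
  have t2 := σ.trans k i j
  unfold Peak Reads
  tauto

theorem pit_iff (σ : LinearOrderOn n) {i j k : Fin n} (hij : i < j) (hjk : j < k) :
    σ.Pit i j k ↔ ¬ (σ.lt i j ∧ σ.lt k j) := by
  have h1 := σ.total i j hij.ne
  have h2 := σ.total j k hjk.ne
  have h3 := σ.total i k (hij.trans hjk).ne
  have a1 := σ.asymm (i := i) (j := j)
  have a2 := σ.asymm (i := j) (j := k)
  have a3 := σ.asymm (i := i) (j := k)
  have t1 := σ.trans j i k
  have t2 := σ.trans j k i
  unfold Pit Reads
  tauto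

/-- On every triple, both orders satisfy the peak condition or both satisfy the pit condition. -/
def PeakPit (σ τ : LinearOrderOn n) : Prop :=
  ∀ i j k : Fin n, i < j → j < k →
    (σ.Peak i j k ∧ τ.Peak i j k) ∨ (σ.Pit i j k ∧ τ.Pit i j k)

/-- The middle element of some triple is the worst one in `σ` and the best one in `τ`. -/
def Opposed (σ τ : LinearOrderOn n) : Prop :=
  ∃ i j k : Fin n, i < j ∧ j < k ∧ (σ.lt j i ∧ σ.lt j k) ∧ (τ.lt i j ∧ τ.lt k j)

/-- An order violates the peak condition when j is worst and the pit condition when j is best, and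
it cannot violate both. So both alternatives fail on a triple only if one order violates peak and
the other pit. -/
theorem peakPit_iff {σ τ : LinearOrderOn n} :
    PeakPit σ τ ↔ ¬ Opposed σ τ ∧ ¬ Opposed τ σ := by
  have excl : ∀ (ρ : LinearOrderOn n) (i j k : Fin n), (ρ.lt j i ∧ ρ.lt j k) →
      ¬ (ρ.lt i j ∧ ρ.lt k j) := fun ρ i j k h h' => ρ.asymm h.1 h'.1
  constructor
  · intro h
    constructor
    · rintro ⟨i, j, k, hij, hjk, h1, h2⟩
      have := h i j k hij hjk
      rw [peak_iff _ hij hjk, pit_iff _ hij hjk, peak_iff _ hij hjk, pit_iff _ hij hjk] at this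
      tauto
    · rintro ⟨i, j, k, hij, hjk, h1, h2⟩
      have := h i j k hij hjk
      rw [peak_iff _ hij hjk, pit_iff _ hij hjk, peak_iff _ hij hjk, pit_iff _ hij hjk] at this
      tauto
  · rintro ⟨h1, h2⟩ i j k hij hjk
    have e1 : ¬ ((σ.lt j i ∧ σ.lt j k) ∧ (τ.lt i j ∧ τ.lt k j)) :=
      fun h => h1 ⟨i, j, k, hij, hjk, h.1, h.2⟩
    have e2 : ¬ ((τ.lt j i ∧ τ.lt j k) ∧ (σ.lt i j ∧ σ.lt k j)) :=
      fun h => h2 ⟨i, j, k, hij, hjk, h.1, h.2⟩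
    have e3 := excl σ i j k
    have e4 := excl τ i j k
    rw [peak_iff _ hij hjk, pit_iff _ hij hjk, peak_iff _ hij hjk, pit_iff _ hij hjk]
    tauto

theorem setOf_lt_mem_Id (σ : LinearOrderOn n) (c : Fin n) : {x | σ.lt x c} ∈ σ.Id :=
  fun _ hx _ hy => σ.trans _ _ _ hy hx

theorem setOf_le_mem_Id (σ : LinearOrderOn n) (c : Fin n) : {x | x = c ∨ σ.lt x c} ∈ σ.Id := by
  rintro x (rfl | hx) y hy
  · exact Or.inr hy
  · exact Or.inr (σ.trans _ _ _ hy hx)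

/-- If the hulls share a point, the one whose left witness is smaller also has a right witness
beyond the left witness of the other. -/
theorem exists_triple_of_not_separated {A B : Set (Fin n)} (h : ¬ Separated A B) :
    ∃ i j k : Fin n, i < j ∧ j < k ∧
      ((i ∈ A \ B ∧ k ∈ A \ B ∧ j ∈ B \ A) ∨ (i ∈ B \ A ∧ k ∈ B \ A ∧ j ∈ A \ B)) := by
  obtain ⟨x, ⟨a, ha, a', ha', h1, h2⟩, ⟨b, hb, b', hb', h3, h4⟩⟩ := Set.not_disjoint_iff.1 h
  have ne : ∀ p q, p ∈ A \ B → q ∈ B \ A → p ≠ q := fun p q hp hq e => hq.2 (e ▸ hp.1)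
  rcases lt_or_gt_of_ne (ne a b ha hb) with hab | hab
  · have hba' : b < a' := lt_of_le_of_ne (h3.trans h2) (ne a' b ha' hb).symm
    exact ⟨a, b, a', hab, hba', Or.inl ⟨ha, ha', hb⟩⟩
  · have hab' : a < b' := lt_of_le_of_ne (h1.trans h4) (ne a b' ha hb')
    exact ⟨b, a, b', hab, hab', Or.inr ⟨hb, hb', ha⟩⟩

/-- For an opposed triple, the ideal of σ up to and including j misses i and k, while the ideal of τ
strictly below j contains both. The point j lies in the two hulls. -/
theorem not_opposed_of_separatedSystem {σ τ : LinearOrderOn n}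
    (h : SeparatedSystem (σ.Id ∪ τ.Id)) : ¬ Opposed σ τ := by
  rintro ⟨i, j, k, hij, hjk, ⟨h1, h2⟩, h3, h4⟩
  have := h _ (Or.inl (σ.setOf_le_mem_Id j)) _ (Or.inr (τ.setOf_lt_mem_Id j))
  refine Set.disjoint_left.1 this (show j ∈ intervalHull _ from ⟨j, ⟨Or.inl rfl, τ.irrefl j⟩, j,
    ⟨Or.inl rfl, τ.irrefl j⟩, le_rfl, le_rfl⟩) ⟨i, ⟨h3, ?_⟩, k, ⟨h4, ?_⟩, hij.le, hjk.le⟩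
  · rintro (e | e)
    · exact hij.ne e
    · exact σ.asymm h1 e
  · rintro (e | e)
    · exact hjk.ne' e
    · exact σ.asymm h2 e

theorem separatedSystem_iff_peakPit {σ τ : LinearOrderOn n} :
    SeparatedSystem (σ.Id ∪ τ.Id) ↔ PeakPit σ τ := by
  rw [peakPit_iff]
  constructor
  · intro h
    exact ⟨not_opposed_of_separatedSystem h, not_opposed_of_separatedSystem (Set.union_comm _ _ ▸ h)⟩
  · rintro ⟨h1, h2⟩ A hA B hB
    -- An order having X as an ideal puts X \ Y before Y \ X. A triple witnessing non-separation is
    -- therefore cyclic for ideals of one order, and opposed for ideals of two.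
    have split : ∀ (ρ : LinearOrderOn n) (X Y : Set (Fin n)), X ∈ ρ.Id → ∀ p q, p ∈ X \ Y →
        q ∈ Y \ X → ρ.lt p q := by
      intro ρ X Y hX p q hp hq
      refine (ρ.total p q fun e => hq.2 (e ▸ hp.1)).resolve_right fun h => hq.2 (hX p hp.1 q h)
    have one : ∀ (ρ : LinearOrderOn n), A ∈ ρ.Id → B ∈ ρ.Id → Separated A B := by
      intro ρ hA hB
      by_contra h
      obtain ⟨i, j, k, -, -, ⟨hi, -, hj⟩ | ⟨hi, -, hj⟩⟩ := exists_triple_of_not_separated h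
      · exact ρ.asymm (split ρ A B hA i j hi hj) (split ρ B A hB j i hj hi)
      · exact ρ.asymm (split ρ B A hB i j hi hj) (split ρ A B hA j i hj hi)
    have two : ∀ (ρ π : LinearOrderOn n), ¬ Opposed ρ π → ¬ Opposed π ρ → A ∈ ρ.Id → B ∈ π.Id →
        Separated A B := by
      intro ρ π h1 h2 hA hB
      by_contra h
      obtain ⟨i, j, k, hij, hjk, ⟨hi, hk, hj⟩ | ⟨hi, hk, hj⟩⟩ := exists_triple_of_not_separated h
      · exact h2 ⟨i, j, k, hij, hjk, ⟨split _ B A hB j i hj hi, split _ B A hB j k hj hk⟩,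
          split _ A B hA i j hi hj, split _ A B hA k j hk hj⟩
      · exact h1 ⟨i, j, k, hij, hjk, ⟨split _ A B hA j i hj hi, split _ A B hA j k hj hk⟩,
          split _ B A hB i j hi hj, split _ B A hB k j hk hj⟩
    rcases hA with hA | hA <;> rcases hB with hB | hB
    · exact one σ hA hB
    · exact two σ τ h1 h2 hA hB
    · exact two τ σ h2 h1 hA hB
    · exact one τ hA hB

theorem lt_sup_of_left {σ τ : LinearOrderOn n} {i j : Fin n} (hij : i < j) (h : σ.lt j i) :
    (σ ⊔ τ).lt j i :=
  le_iff.1 (le_sup_left : σ ≤ σ ⊔ τ) i j hij h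

theorem lt_of_inf_lt {σ τ : LinearOrderOn n} {i j : Fin n} (hij : i < j) (h : (σ ⊓ τ).lt j i) :
    σ.lt j i :=
  le_iff.1 (inf_le_left : σ ⊓ τ ≤ σ) i j hij h

/-- The test ideal is the one of σ up to and including j, which misses i and k. The inversion (j, k)
of τ puts k before j in the join; the non-inversion (i, j) of τ puts i before j in the meet. So it
is an ideal of neither. -/
theorem not_opposed_of_Id_subset {σ τ : LinearOrderOn n}
    (h : σ.Id ⊆ (σ ⊔ τ).Id ∪ (σ ⊓ τ).Id) : ¬ Opposed σ τ := by
  rintro ⟨i, j, k, hij, hjk, ⟨h1, h2⟩, h3, h4⟩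
  rcases h (σ.setOf_le_mem_Id j) with hX | hX
  · have : (σ ⊔ τ).lt k j := by
      rw [sup_comm]
      exact lt_sup_of_left hjk h4
    rcases hX j (Or.inl rfl) k this with e | e
    · exact hjk.ne' e
    · exact σ.asymm h2 e
  · have : (σ ⊓ τ).lt i j := by
      rw [← not_lt_iff hij.ne']
      intro e
      rw [inf_comm] at e
      exact τ.asymm h3 (lt_of_inf_lt hij e)
    rcases hX j (Or.inl rfl) i this with e | e
    · exact hij.ne e
    · exact σ.asymm h1 e

/-- The pair `{c, x}` is inverted in `σ` and not in `τ`. -/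
def Over (σ τ : LinearOrderOn n) (c x : Fin n) : Prop :=
  (c < x ∧ σ.lt x c ∧ τ.lt c x) ∨ (x < c ∧ σ.lt c x ∧ τ.lt x c)

/-- For each `c`, one of the two orders inverts all the pairs through `c` that the other does. -/
def LocallyNested (σ τ : LinearOrderOn n) : Prop :=
  ∀ c x y, Over σ τ c x → ¬ Over τ σ c y

theorem LocallyNested.symm {σ τ : LinearOrderOn n} (h : LocallyNested σ τ) : LocallyNested τ σ :=
  fun c x y h1 h2 => h c y x h2 h1

theorem Over.symm {σ τ : LinearOrderOn n} {c x : Fin n} (h : Over σ τ c x) : Over σ τ x c := by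
  rcases h with h | h
  · exact Or.inr h
  · exact Or.inl h

/-- Suppose c lies in one pair inverted by σ only and one inverted by τ only. If c is between x and
y, it is the middle of an opposed triple. Otherwise σ and τ order x, c, y oppositely with c second,
and whichever of x, y is nearer to c on the line is the middle of an opposed triple. -/
theorem PeakPit.locallyNested {σ τ : LinearOrderOn n} (h : PeakPit σ τ) : LocallyNested σ τ := by
  obtain ⟨h1, h2⟩ := peakPit_iff.1 h
  rintro c x y (⟨a1, a2, a3⟩ | ⟨a1, a2, a3⟩) (⟨b1, b2, b3⟩ | ⟨b1, b2, b3⟩)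
  · have s1 := σ.trans _ _ _ a2 b3
    have s2 := τ.trans _ _ _ b2 a3
    rcases lt_trichotomy x y with hxy | rfl | hxy
    · exact h1 ⟨c, x, y, a1, hxy, ⟨a2, s1⟩, a3, s2⟩
    · exact σ.asymm a2 b3
    · exact h2 ⟨c, y, x, b1, hxy, ⟨b2, s2⟩, b3, s1⟩
  · exact h2 ⟨y, c, x, b1, a1, ⟨b2, a3⟩, b3, a2⟩
  · exact h1 ⟨x, c, y, a1, b1, ⟨a2, b3⟩, a3, b2⟩
  · have s1 := σ.trans _ _ _ b3 a2
    have s2 := τ.trans _ _ _ a3 b2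
    rcases lt_trichotomy x y with hxy | rfl | hxy
    · exact h1 ⟨x, y, c, hxy, b1, ⟨s1, b3⟩, s2, b2⟩
    · exact σ.asymm a2 b3
    · exact h2 ⟨y, x, c, hxy, a1, ⟨s2, a3⟩, s1, a2⟩

/-- For locally nested orders the union of the inversion sets is an inversion set. -/
theorem LocallyNested.joinInv {σ τ : LinearOrderOn n} (h : LocallyNested σ τ) {i j : Fin n}
    (hij : JoinInv σ τ i j) : σ.lt j i ∨ τ.lt j i := by
  induction hij with
  | single h => exact h.2
  | @tail b c hb hbc ih =>
    have hib := JoinInv.lt hb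
    obtain ⟨hbc1, hbc2⟩ := hbc
    by_cases h1 : σ.lt b i ∧ σ.lt c b
    · exact Or.inl (σ.trans _ _ _ h1.2 h1.1)
    by_cases h2 : τ.lt b i ∧ τ.lt c b
    · exact Or.inr (τ.trans _ _ _ h2.2 h2.1)
    -- One of the pairs (i, b), (b, c) is now inverted by σ only and the other by τ only, and they
    -- share b.
    exfalso
    rcases ih with ih | ih
    · have h3 : τ.lt c b := hbc2.resolve_left fun e => h1 ⟨ih, e⟩
      exact h b i c (Or.inr ⟨hib, ih, (not_lt_iff hib.ne').1 fun e => h2 ⟨e, h3⟩⟩)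
        (Or.inl ⟨hbc1, h3, (not_lt_iff hbc1.ne').1 fun e => h1 ⟨ih, e⟩⟩)
    · have h3 : σ.lt c b := hbc2.resolve_right fun e => h2 ⟨ih, e⟩
      exact h b c i (Or.inl ⟨hbc1, h3, (not_lt_iff hbc1.ne').1 fun e => h2 ⟨ih, e⟩⟩)
        (Or.inr ⟨hib, ih, (not_lt_iff hib.ne').1 fun e => h1 ⟨e, h3⟩⟩)

theorem LocallyNested.sup_lt_iff {σ τ : LinearOrderOn n} (h : LocallyNested σ τ) {i j : Fin n}
    (hij : i < j) : (σ ⊔ τ).lt j i ↔ σ.lt j i ∨ τ.lt j i :=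
  (join_lt_iff hij).trans
    ⟨h.joinInv, fun h' => Relation.TransGen.single ⟨hij, h'⟩⟩

theorem LocallyNested.rev {σ τ : LinearOrderOn n} (h : LocallyNested σ τ) :
    LocallyNested σ.rev τ.rev := by
  intro c x y h1 h2
  refine h c y x ?_ ?_
  · rcases h2 with ⟨a, b, c⟩ | ⟨a, b, c⟩
    · exact Or.inl ⟨a, c, b⟩
    · exact Or.inr ⟨a, c, b⟩
  · rcases h1 with ⟨a, b, c⟩ | ⟨a, b, c⟩
    · exact Or.inl ⟨a, c, b⟩
    · exact Or.inr ⟨a, c, b⟩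

theorem inf_eq (σ τ : LinearOrderOn n) : σ ⊓ τ = (σ.rev ⊔ τ.rev).rev := rfl

theorem LocallyNested.inf_lt_iff {σ τ : LinearOrderOn n} (h : LocallyNested σ τ) {i j : Fin n}
    (hij : i < j) : (σ ⊓ τ).lt j i ↔ σ.lt j i ∧ τ.lt j i := by
  have := h.rev.sup_lt_iff hij
  rw [inf_eq, ← not_lt_iff hij.ne, ← not_lt_iff hij.ne, ← not_lt_iff hij.ne]
  change ¬ (σ.rev ⊔ τ.rev).lt j i ↔ _
  rw [this, not_or]
  rfl

theorem LocallyNested.over_of_sup_lt {σ τ : LinearOrderOn n} (h : LocallyNested σ τ)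
    {a b : Fin n} (h1 : σ.lt a b) (h2 : (σ ⊔ τ).lt b a) : Over τ σ a b := by
  rcases lt_or_gt_of_ne (ne_of_lt h1) with hab | hab
  · exact Or.inl ⟨hab, ((h.sup_lt_iff hab).1 h2).resolve_left (σ.asymm h1), h1⟩
  · exact absurd h2 ((σ ⊔ τ).asymm (lt_sup_of_left hab h1))

theorem LocallyNested.over_of_inf_lt {σ τ : LinearOrderOn n} (h : LocallyNested σ τ)
    {a b : Fin n} (h1 : σ.lt a b) (h2 : (σ ⊓ τ).lt b a) : Over σ τ a b := by
  rcases lt_or_gt_of_ne (ne_of_lt h1) with hab | hab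
  · exact absurd h1 (σ.asymm (lt_of_inf_lt hab h2))
  · refine Or.inr ⟨hab, h1, (not_lt_iff hab.ne').1 fun e => ?_⟩
    exact (σ ⊓ τ).asymm h2 ((h.inf_lt_iff hab).2 ⟨h1, e⟩)

theorem not_forall_lt_iff {σ π : LinearOrderOn n} {c : Fin n}
    (h : ¬ ∀ x, σ.lt x c ↔ π.lt x c) :
    ∃ x, (σ.lt x c ∧ π.lt c x) ∨ (σ.lt c x ∧ π.lt x c) := by
  obtain ⟨x, hx⟩ := not_forall.1 h
  have hne : x ≠ c := by
    rintro rfl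
    exact hx ⟨fun e => absurd e (σ.irrefl _), fun e => absurd e (π.irrefl _)⟩
  refine ⟨x, ?_⟩
  rw [← not_lt_iff (σ := σ) hne, ← not_lt_iff (σ := π) hne]
  tauto

/-- A discrepancy with the join at c comes from a pair through c inverted by τ only, a discrepancy
with the meet from one inverted by σ only; local nestedness forbids having both. This places each
edge of the snake of σ on the snake of the join or of the meet. -/
theorem LocallyNested.lower_eq {σ τ : LinearOrderOn n} (h : LocallyNested σ τ) (c : Fin n) :
    (∀ x, σ.lt x c ↔ (σ ⊔ τ).lt x c) ∨ (∀ x, σ.lt x c ↔ (σ ⊓ τ).lt x c) := by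
  by_contra hc
  obtain ⟨h1, h2⟩ := not_or.1 hc
  obtain ⟨x, hx⟩ := not_forall_lt_iff h1
  obtain ⟨y, hy⟩ := not_forall_lt_iff h2
  have hx' : Over τ σ c x := hx.elim (fun e => (h.over_of_sup_lt e.1 e.2).symm)
    fun e => h.over_of_sup_lt e.1 e.2
  have hy' : Over σ τ c y := hy.elim (fun e => (h.over_of_inf_lt e.1 e.2).symm)
    fun e => h.over_of_inf_lt e.1 e.2
  exact h c y x hy' hx'

theorem exists_of_notMem_Id {σ : LinearOrderOn n} {X : Set (Fin n)} (h : X ∉ σ.Id) :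
    ∃ a ∈ X, ∃ b ∉ X, σ.lt b a := by
  by_contra! hc
  exact h fun x hx y hy => by
    by_contra hy'
    exact hc x hx y hy' hy

theorem lt_of_mem_Id {σ : LinearOrderOn n} {X : Set (Fin n)} (h : X ∈ σ.Id) {a b : Fin n}
    (ha : a ∈ X) (hb : b ∉ X) : σ.lt a b :=
  (σ.total a b fun e => hb (e ▸ ha)).resolve_right fun e => hb (h a ha b e)

/-- A pair meeting both an inversion of `σ` only and an inversion of `τ` only is ordered
in the same way by `σ` and `τ`. -/
theorem LocallyNested.lt_of_over {σ τ : LinearOrderOn n} (h : LocallyNested σ τ)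
    {a a' b b' : Fin n} (h1 : Over τ σ a b) (h2 : Over σ τ a' b') (h3 : σ.lt a a') :
    τ.lt a a' := by
  have hne := ne_of_lt h3
  by_contra hc
  have hc := (not_lt_iff hne).1 hc
  rcases lt_or_gt_of_ne hne with hlt | hlt
  · exact h a' b' a h2 (Or.inr ⟨hlt, hc, h3⟩)
  · exact h a a' b (Or.inr ⟨hlt, h3, hc⟩) h1

theorem Over.lt_right {σ τ : LinearOrderOn n} {a b : Fin n} (h : Over σ τ a b) (h' : σ.lt a b) :
    τ.lt b a := by
  rcases h with h | h
  · exact absurd h' (σ.asymm h.2.1)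
  · exact h.2.2

theorem Over.lt_left {σ τ : LinearOrderOn n} {a b : Fin n} (h : Over σ τ a b) (h' : τ.lt a b) :
    σ.lt b a := by
  rcases h with h | h
  · exact h.2.1
  · exact absurd h' (τ.asymm h.2.2)

/-- A failure in the join gives a pair a ∈ X, b ∉ X inverted by τ only; one in the meet gives a' ∈
X, b' ∉ X inverted by σ only. Both pairs are reversed in τ, while the crossed pairs keep their
order, so τ contains the cycle b, a, b', a', b. -/
theorem LocallyNested.Id_subset {σ τ : LinearOrderOn n} (h : LocallyNested σ τ) :
    σ.Id ⊆ (σ ⊔ τ).Id ∪ (σ ⊓ τ).Id := by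
  intro X hX
  by_contra hc
  obtain ⟨h1, h2⟩ := not_or.1 hc
  obtain ⟨a, ha, b, hb, hba⟩ := exists_of_notMem_Id h1
  obtain ⟨a', ha', b', hb', hba'⟩ := exists_of_notMem_Id h2
  have o := h.over_of_sup_lt (lt_of_mem_Id hX ha hb) hba
  have o' := h.over_of_inf_lt (lt_of_mem_Id hX ha' hb') hba'
  have t1 : τ.lt b a := o.lt_left (lt_of_mem_Id hX ha hb)
  have t2 : τ.lt b' a' := o'.lt_right (lt_of_mem_Id hX ha' hb')
  have t3 : τ.lt a b' := h.lt_of_over o o'.symm (lt_of_mem_Id hX ha hb')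
  have t4 : τ.lt a' b := by
    have := lt_of_mem_Id hX ha' hb
    by_contra hc
    have e := (not_lt_iff (ne_of_lt this)).1 hc
    rcases lt_or_gt_of_ne (ne_of_lt this) with hlt | hlt
    · exact h a' b' b o' (Or.inl ⟨hlt, e, this⟩)
    · exact h b a' a (Or.inl ⟨hlt, this, e⟩) o.symm
  exact τ.asymm (τ.trans _ _ _ t1 t3) (τ.trans _ _ _ t2 t4)

/-- With witnesses a, b against σ and a', b' against τ, local nestedness orders the crossed pairs so
that σ reads a', b, a and τ reads a, b', a'. Thus {a, a'} is inverted by exactly one order, and it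
conflicts with the other kind of pair at a or at a'. -/
theorem LocallyNested.Id_sup_subset {σ τ : LinearOrderOn n} (h : LocallyNested σ τ) :
    (σ ⊔ τ).Id ⊆ σ.Id ∪ τ.Id := by
  intro X hX
  by_contra hc
  obtain ⟨h1, h2⟩ := not_or.1 hc
  obtain ⟨a, ha, b, hb, hba⟩ := exists_of_notMem_Id h1
  obtain ⟨a', ha', b', hb', hba'⟩ := exists_of_notMem_Id h2
  have o : Over τ σ b a := h.over_of_sup_lt hba (lt_of_mem_Id hX ha hb)
  have o' : Over σ τ b' a' :=
    h.symm.over_of_sup_lt hba' (by rw [sup_comm]; exact lt_of_mem_Id hX ha' hb')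
  have l1 := lt_of_mem_Id hX ha hb'
  have l2 := lt_of_mem_Id hX ha' hb
  have s1 : σ.lt a' b := by
    by_contra hc
    exact h a' b' b o'.symm
      (h.over_of_sup_lt ((not_lt_iff (ne_of_lt l2)).1 hc) l2).symm
  have t1 : τ.lt a b' := by
    by_contra hc
    rw [sup_comm] at l1
    exact h a b' b (h.symm.over_of_sup_lt ((not_lt_iff (ne_of_lt l1)).1 hc) l1).symm o.symm
  have s2 := σ.trans _ _ _ s1 hba
  have t2 := τ.trans _ _ _ t1 hba'
  rcases lt_or_gt_of_ne (ne_of_lt t2) with hlt | hlt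
  · exact h a a' b (Or.inl ⟨hlt, s2, t2⟩) o.symm
  · exact h a' b' a o'.symm (Or.inl ⟨hlt, t2, s2⟩)

theorem mem_Id_rev {σ : LinearOrderOn n} {X : Set (Fin n)} : X ∈ σ.rev.Id ↔ Xᶜ ∈ σ.Id := by
  constructor
  · intro h x hx y hy hy'
    exact hx (h y hy' x hy)
  · intro h x hx y hy
    by_contra hy'
    exact h y hy' x hy hx

theorem LocallyNested.Id_inf_subset {σ τ : LinearOrderOn n} (h : LocallyNested σ τ) :
    (σ ⊓ τ).Id ⊆ σ.Id ∪ τ.Id := by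
  intro X hX
  rw [inf_eq, mem_Id_rev] at hX
  have := h.rev.Id_sup_subset hX
  simpa only [Set.mem_union, mem_Id_rev, compl_compl] using this

theorem LocallyNested.Id_union_eq {σ τ : LinearOrderOn n} (h : LocallyNested σ τ) :
    σ.Id ∪ τ.Id = (σ ⊔ τ).Id ∪ (σ ⊓ τ).Id := by
  refine (Set.union_subset h.Id_subset ?_).antisymm
    (Set.union_subset h.Id_sup_subset h.Id_inf_subset)
  rw [sup_comm, inf_comm]
  exact h.symm.Id_subset

end LinearOrderOn

/-! ### Adjacent transpositions and chains in the Bruhat order -/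

namespace LinearOrderOn

variable {n : ℕ}

/-- `β` is obtained from `α` by swapping the consecutive elements `i < j`. -/
structure IsFlip (α β : LinearOrderOn n) (i j : Fin n) : Prop where
  lt : i < j
  left : α.lt i j
  right : β.lt j i
  agree : ∀ x y, (x = i → y ≠ j) → (x = j → y ≠ i) → (α.lt x y ↔ β.lt x y)

namespace IsFlip

variable {α β : LinearOrderOn n} {i j : Fin n}

theorem lt_iff_of_ne (h : IsFlip α β i j) {c : Fin n} (hi : c ≠ i) (hj : c ≠ j) (x : Fin n) :
    α.lt x c ↔ β.lt x c :=
  h.agree x c (fun _ => hj) fun _ => hi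

theorem lt_left_iff (h : IsFlip α β i j) (x : Fin n) : α.lt x i ↔ β.lt x j := by
  by_cases hi : x = i
  · subst hi
    exact iff_of_false (α.irrefl _) (β.asymm h.right)
  by_cases hj : x = j
  · subst hj
    exact iff_of_false (α.asymm h.left) (β.irrefl _)
  have e1 := h.agree x i (fun e => absurd e hi) fun e => absurd e hj
  have e2 := h.agree x j (fun e => absurd e hi) fun e => absurd e hj
  constructor
  · intro h'
    exact e2.1 (α.trans _ _ _ h' h.left)
  · intro h'
    exact e1.2 (β.trans _ _ _ h' h.right)

theorem rev (h : IsFlip α β i j) : IsFlip β.rev α.rev i j where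
  lt := h.lt
  left := h.right
  right := h.left
  agree x y h1 h2 := (h.agree y x (fun e e' => h2 e' e) fun e e' => h1 e' e).symm

theorem lt_right_iff (h : IsFlip α β i j) (x : Fin n) : α.lt x j ↔ x = i ∨ α.lt x i := by
  by_cases hi : x = i
  · subst hi
    exact iff_of_true h.left (Or.inl rfl)
  by_cases hj : x = j
  · subst hj
    exact iff_of_false (α.irrefl _) (by rintro (e | e); exacts [hi e, α.asymm h.left e])
  rw [h.lt_left_iff, h.agree x j (fun e => absurd e hi) fun e => absurd e hj]
  simp [hi]

theorem lt_left_iff' (h : IsFlip α β i j) (x : Fin n) : β.lt x i ↔ x = j ∨ β.lt x j := by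
  by_cases hj : x = j
  · subst hj
    exact iff_of_true h.right (Or.inl rfl)
  by_cases hi : x = i
  · subst hi
    exact iff_of_false (β.irrefl _) (by rintro (e | e); exacts [hj e, β.asymm h.right e])
  rw [← h.lt_left_iff, h.agree x i (fun e => absurd e hi) fun e => absurd e hj]
  simp [hj]

/-- A flip adds exactly one inversion, the pair (i, j). -/
theorem le_iff_inv (h : IsFlip α β i j) {ρ : LinearOrderOn n} :
    β ≤ ρ ↔ α ≤ ρ ∧ ρ.lt j i := by
  rw [le_iff, le_iff]
  constructor
  · intro h'
    refine ⟨fun x y hxy hx => ?_, h' i j h.lt h.right⟩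
    refine h' x y hxy ((h.agree y x ?_ ?_).1 hx)
    · rintro rfl rfl
      exact lt_asymm hxy h.lt
    · rintro rfl rfl
      exact α.asymm h.left hx
  · rintro ⟨h1, h2⟩ x y hxy hx
    by_cases e : y = j ∧ x = i
    · rw [e.1, e.2]
      exact h2
    · refine h1 x y hxy ((h.agree y x ?_ ?_).2 hx)
      · rintro rfl rfl
        exact lt_asymm hxy h.lt
      · rintro rfl rfl
        exact e ⟨rfl, rfl⟩

theorem le (h : IsFlip α β i j) : α ≤ β := (h.le_iff_inv.1 le_rfl).1

theorem lt' (h : IsFlip α β i j) : α < β :=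
  lt_of_le_of_ne h.le fun e => α.asymm h.left (e ▸ h.right)

end IsFlip

/-- Consecutive elements `i < j` can be swapped. -/
theorem exists_isFlip {α : LinearOrderOn n} {i j : Fin n} (hij : i < j) (h : α.lt i j)
    (hadj : ∀ x, α.lt i x → ¬ α.lt x j) : ∃ β, IsFlip α β i j := by
  have le_j : ∀ x, α.lt i x → x = j ∨ α.lt j x := fun x hx => by
    by_cases e : x = j
    · exact Or.inl e
    · exact Or.inr ((not_lt_iff e).1 (hadj x hx))
  have le_i : ∀ x, α.lt x j → x = i ∨ α.lt x i := fun x hx => by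
    by_cases e : x = i
    · exact Or.inl e
    · exact Or.inr ((not_lt_iff (Ne.symm e)).1 fun e' => hadj x e' hx)
  refine ⟨⟨fun x y => (α.lt x y ∧ ¬ (x = i ∧ y = j)) ∨ (x = j ∧ y = i), ?_, ?_, ?_⟩,
    hij, h, Or.inr ⟨rfl, rfl⟩, ?_⟩
  · rintro x (e | e)
    · exact α.irrefl x e.1
    · exact hij.ne (e.2.symm.trans e.1)
  · rintro x y z (⟨h1, h2⟩ | ⟨rfl, rfl⟩) (⟨h3, h4⟩ | ⟨rfl, rfl⟩)
    · refine Or.inl ⟨α.trans _ _ _ h1 h3, ?_⟩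
      rintro ⟨rfl, rfl⟩
      exact hadj y h1 h3
    · rcases le_i x h1 with rfl | h5
      · exact absurd ⟨rfl, rfl⟩ h2
      · exact Or.inl ⟨h5, fun e => hij.ne e.2⟩
    · rcases le_j z h3 with rfl | h5
      · exact absurd ⟨rfl, rfl⟩ h4
      · exact Or.inl ⟨h5, fun e => hij.ne' e.1⟩
    · exact absurd hij (lt_irrefl _)
  · intro x y hxy
    by_cases e1 : x = i ∧ y = j
    · exact Or.inr (Or.inr e1.symm)
    by_cases e2 : x = j ∧ y = i
    · exact Or.inl (Or.inr e2)
    · rcases α.total x y hxy with h1 | h1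
      · exact Or.inl (Or.inl ⟨h1, e1⟩)
      · exact Or.inr (Or.inl ⟨h1, fun e => e2 e.symm⟩)
  · intro x y h1 h2
    constructor
    · intro h3
      exact Or.inl ⟨h3, fun e => h1 e.1 e.2⟩
    · rintro (e | e)
      · exact e.1
      · exact absurd e.2 (h2 e.1)

/-- Two different orders differ on a pair of consecutive elements. -/
theorem exists_adjacent {α β : LinearOrderOn n} {i j : Fin n} (h1 : α.lt i j) (h2 : β.lt j i) :
    ∃ a b, α.lt a b ∧ β.lt b a ∧ ∀ x, α.lt a x → ¬ α.lt x b := by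
  induction hm : Set.ncard {x | α.lt i x ∧ α.lt x j} using Nat.strong_induction_on
    generalizing i j with
  | _ m ih =>
    by_cases hadj : ∀ x, α.lt i x → ¬ α.lt x j
    · exact ⟨i, j, h1, h2, hadj⟩
    push Not at hadj
    obtain ⟨x, hix, hxj⟩ := hadj
    -- Since β puts j before i, it reverses one of the pairs (x, j), (i, x), and each has fewer
    -- elements of α between its members.
    rcases β.total i x (ne_of_lt hix) with h3 | h3
    · refine ih _ ?_ hxj (β.trans _ _ _ h2 h3) rfl
      rw [← hm]
      refine Set.ncard_lt_ncard ⟨fun y hy => ⟨α.trans _ _ _ hix hy.1, hy.2⟩, fun hs => ?_⟩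
      exact α.irrefl x (hs ⟨hix, hxj⟩).1
    · refine ih _ ?_ hix h3 rfl
      rw [← hm]
      refine Set.ncard_lt_ncard ⟨fun y hy => ⟨hy.1, α.trans _ _ _ hy.2 hxj⟩, fun hs => ?_⟩
      exact α.irrefl x (hs ⟨hix, hxj⟩).2

theorem exists_isFlip_le {α β : LinearOrderOn n} (h : α < β) :
    ∃ γ i j, IsFlip α γ i j ∧ γ ≤ β := by
  have : ∃ i j, α.lt i j ∧ β.lt j i := by
    by_contra! hc
    refine h.not_ge (le_iff.2 fun i j hij hb => ?_)
    by_contra ha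
    exact hc i j ((not_lt_iff hij.ne').1 ha) hb
  obtain ⟨i, j, h1, h2⟩ := this
  obtain ⟨a, b, h1, h2, h3⟩ := exists_adjacent h1 h2
  have hab : a < b := by
    refine lt_of_le_of_ne (le_of_not_gt fun hba => ?_) (ne_of_lt h1)
    exact β.asymm h2 (le_iff.1 h.le b a hba h1)
  obtain ⟨γ, hγ⟩ := exists_isFlip hab h1 h3
  exact ⟨γ, a, b, hγ, hγ.le_iff_inv.2 ⟨h.le, h2⟩⟩

/-- Finiteness makes induction from the top of the Bruhat order available. -/
instance : Finite (LinearOrderOn n) :=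
  Finite.of_injective (fun σ => σ.lt) fun _ _ h => LinearOrderOn.ext h

/-- The orders `α ≤ β` are joined by flips. -/
theorem reflTransGen_isFlip {α β : LinearOrderOn n} (h : α ≤ β) :
    Relation.ReflTransGen (fun α β => ∃ i j, IsFlip α β i j) α β := by
  induction α using WellFoundedGT.induction with
  | _ α ih =>
    rcases h.eq_or_lt with rfl | h
    · exact Relation.ReflTransGen.refl
    · obtain ⟨γ, i, j, hf, hγ⟩ := exists_isFlip_le h
      exact Relation.ReflTransGen.head ⟨i, j, hf⟩ (ih γ hf.lt' hγ)

/-- The order `1 < 2 < ⋯ < n`. -/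
def natural (n : ℕ) : LinearOrderOn n where
  lt i j := i < j
  irrefl := lt_irrefl
  trans _ _ _ := lt_trans
  total _ _ := lt_or_gt_of_ne

theorem natural_le (σ : LinearOrderOn n) : natural n ≤ σ :=
  le_iff.2 fun _ _ hij h => absurd hij (lt_asymm h)

theorem le_rev_natural (σ : LinearOrderOn n) : σ ≤ (natural n).rev :=
  le_iff.2 fun _ _ hij _ => hij

end LinearOrderOn

/-- A sequence of steps can be extended to the left by a chain of steps. -/
theorem Relation.ReflTransGen.exists_seq {S : Type*} {R : S → S → Prop} {a b : S}
    (h : Relation.ReflTransGen R a b) (c₀ : ℕ → S) (N₀ : ℕ) (h0 : c₀ 0 = b)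
    (hR : ∀ s < N₀, R (c₀ s) (c₀ (s + 1))) :
    ∃ (c : ℕ → S) (m : ℕ), c 0 = a ∧ (∀ s, c (s + m) = c₀ s) ∧
      ∀ s < N₀ + m, R (c s) (c (s + 1)) := by
  induction h using Relation.ReflTransGen.head_induction_on with
  | refl => exact ⟨c₀, 0, h0, fun _ => rfl, hR⟩
  | @head a a' h1 h2 ih =>
    obtain ⟨c, m, h3, h4, h5⟩ := ih
    refine ⟨fun s => Nat.casesOn s a c, m + 1, rfl, h4, fun s hs => ?_⟩
    cases s with
    | zero =>
      change R a (c 0)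
      rwa [h3]
    | succ s => exact h5 s (Nat.lt_of_succ_lt_succ hs)

/-! ### Snakes as curves parametrized by height -/

/-- The determinant of two vectors of the plane. -/
def wedge (z w : ℂ) : ℝ := z.re * w.im - z.im * w.re

namespace LinearOrderOn

variable {n : ℕ}

theorem exists_first (α : LinearOrderOn n) {S : Set (Fin n)} (hS : S.Nonempty) :
    ∃ c ∈ S, ∀ x ∈ S, ¬ α.lt x c := by
  have : IsTrans (Fin n) α.lt := ⟨α.trans⟩
  have : Std.Irrefl α.lt := ⟨α.irrefl⟩
  have wf : WellFounded α.lt := Finite.wellFounded_of_trans_of_irrefl α.lt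
  exact wf.has_min S hS

open Classical in
/-- The lower end of the edge of color `c` in the snake of `α`. -/
noncomputable def foot (ξ : Fin n → ℂ) (α : LinearOrderOn n) (c : Fin n) : ℂ :=
  ∑ x, if α.lt x c then ξ x else 0

theorem foot_congr (ξ : Fin n → ℂ) {α β : LinearOrderOn n} {c d : Fin n}
    (h : ∀ x, α.lt x c ↔ β.lt x d) : foot ξ α c = foot ξ β d := by
  classical
  exact Finset.sum_congr rfl fun x _ => if_congr (h x) rfl rfl

theorem foot_insert (ξ : Fin n → ℂ) {α β : LinearOrderOn n} {c d : Fin n}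
    (h : ∀ x, α.lt x d ↔ x = c ∨ β.lt x c) : foot ξ α d = foot ξ β c + ξ c := by
  classical
  unfold foot
  have : ∀ x, (if α.lt x d then ξ x else 0)
      = (if β.lt x c then ξ x else 0) + if x = c then ξ x else 0 := by
    intro x
    by_cases hx : x = c
    · subst hx
      simp [h, β.irrefl]
    · simp [h, hx]
  simp [this, Finset.sum_add_distrib]

theorem foot_eq_zero (ξ : Fin n → ℂ) {α : LinearOrderOn n} {c : Fin n}
    (h : ∀ x, ¬ α.lt x c) : foot ξ α c = 0 := by
  simp [foot, h]

theorem foot_rev_add (ξ : Fin n → ℂ) (α : LinearOrderOn n) (c : Fin n) :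
    foot ξ α c + ξ c + foot ξ α.rev c = ∑ x, ξ x := by
  classical
  have : ∀ x, (if α.lt x c then ξ x else 0) + (if x = c then ξ x else 0)
      + (if α.rev.lt x c then ξ x else 0) = ξ x := by
    intro x
    change _ + (if α.lt c x then ξ x else 0) = _
    by_cases hx : x = c
    · subst hx
      simp [α.irrefl]
    · rcases α.total x c hx with h | h
      · simp [h, hx, α.asymm h]
      · simp [h, hx, α.asymm h]
  simp only [foot]
  conv_rhs => rw [← Finset.sum_congr rfl fun x _ => this x]
  simp [Finset.sum_add_distrib]

theorem foot_add_of_last (ξ : Fin n → ℂ) {α : LinearOrderOn n} {c : Fin n}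
    (h : ∀ x, ¬ α.lt c x) : foot ξ α c + ξ c = ∑ x, ξ x := by
  rw [← foot_rev_add ξ α c, foot_eq_zero ξ (α := α.rev) (c := c) h, add_zero]

theorem exists_next {α : LinearOrderOn n} {c : Fin n} (h : ∃ x, α.lt c x) :
    ∃ d, α.lt c d ∧ (∀ x, α.lt c x → ¬ α.lt x d) ∧ ∀ x, α.lt x d ↔ x = c ∨ α.lt x c := by
  obtain ⟨d, h1, h2⟩ := α.exists_first (S := {x | α.lt c x}) h
  refine ⟨d, h1, h2, fun x => ⟨fun hx => ?_, ?_⟩⟩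
  · by_cases e : x = c
    · exact Or.inl e
    · exact Or.inr ((not_lt_iff (Ne.symm e)).1 fun e' => h2 x e' hx)
  · rintro (rfl | e)
    · exact h1
    · exact α.trans _ _ _ e h1

section Frame

variable {ξ : Fin n → ℂ}

theorem im_foot (ξ : Fin n → ℂ) (α : LinearOrderOn n) (c : Fin n) [DecidableRel α.lt] :
    (foot ξ α c).im = ∑ x, if α.lt x c then (ξ x).im else 0 := by
  simp only [foot, Complex.im_sum]
  refine Finset.sum_congr rfl fun x _ => ?_
  split_ifs <;> rfl

theorem im_foot_add_le_of_lt (hξ : IsZonogonFrame ξ) {α : LinearOrderOn n} {c d : Fin n}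
    (h : α.lt c d) : (foot ξ α c).im + (ξ c).im ≤ (foot ξ α d).im := by
  classical
  rw [im_foot, im_foot, ← Finset.sum_ite_eq' Finset.univ c (fun x => (ξ x).im) |>.trans
    (if_pos (Finset.mem_univ c)), ← Finset.sum_add_distrib]
  refine Finset.sum_le_sum fun x _ => ?_
  have := (hξ.upper x).le
  by_cases hx : x = c
  · subst hx
    simp [h, α.irrefl]
  · by_cases h1 : α.lt x c
    · simp [hx, h1, α.trans _ _ _ h1 h]
    · simp only [h1, hx, if_false, add_zero]
      split_ifs
      exacts [this, le_rfl]

/-- The point at height `y` of the snake of `α`. -/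
noncomputable def snakePoint (ξ : Fin n → ℂ) (α : LinearOrderOn n) (y : ℝ) : ℂ :=
  ∑ c, ((max 0 (min 1 ((y - (foot ξ α c).im) / (ξ c).im)) : ℝ) : ℂ) * ξ c

/-- The edges of a snake occupy successive ranges of height. At a height in the range of c, the
clamped coefficient is 1 for the colors before c, 0 for those after c, and a for c itself. -/
theorem snakePoint_eq (hξ : IsZonogonFrame ξ) (α : LinearOrderOn n) {c : Fin n} {a y : ℝ}
    (h0 : 0 ≤ a) (h1 : a ≤ 1) (hy : y = (foot ξ α c + a * ξ c).im) :
    snakePoint ξ α y = foot ξ α c + a * ξ c := by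
  classical
  have hc := hξ.upper c
  have hy' : y = (foot ξ α c).im + a * (ξ c).im := by simp [hy]
  have key : ∀ x, ((max 0 (min 1 ((y - (foot ξ α x).im) / (ξ x).im)) : ℝ) : ℂ) * ξ x
      = (if α.lt x c then ξ x else 0) + if x = c then (a : ℂ) * ξ x else 0 := by
    intro x
    have hx := hξ.upper x
    by_cases e : x = c
    · subst e
      have : (y - (foot ξ α x).im) / (ξ x).im = a := by
        rw [hy']
        field_simp
        ring
      simp [this, h0, h1, α.irrefl]
    rcases α.total x c e with h | h
    · have h2 := im_foot_add_le_of_lt hξ h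
      have : 1 ≤ (y - (foot ξ α x).im) / (ξ x).im := by
        rw [le_div_iff₀ hx]
        nlinarith
      simp [this, h, e]
    · have h2 := im_foot_add_le_of_lt hξ h
      have : (y - (foot ξ α x).im) / (ξ x).im ≤ 0 := by
        apply div_nonpos_of_nonpos_of_nonneg _ hx.le
        nlinarith
      simp [this, α.asymm h, e, this.trans zero_le_one]
  rw [snakePoint, Finset.sum_congr rfl fun x _ => key x, Finset.sum_add_distrib]
  simp [foot]

/-- At each height the snake of `α` has a point. -/
theorem exists_edge (hξ : IsZonogonFrame ξ) (hn : 0 < n) (α : LinearOrderOn n) {y : ℝ}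
    (h0 : 0 ≤ y) (h1 : y ≤ (∑ x, ξ x).im) :
    ∃ (c : Fin n) (a : ℝ), 0 ≤ a ∧ a ≤ 1 ∧ y = (foot ξ α c + a * ξ c).im := by
  classical
  obtain ⟨f, -, hf⟩ := α.exists_first (S := Set.univ) ⟨⟨0, hn⟩, trivial⟩
  have hf0 := foot_eq_zero ξ fun x => hf x trivial
  obtain ⟨c, hc, hmax⟩ := Finset.exists_max_image
    (Finset.univ.filter fun c => (foot ξ α c).im ≤ y) (fun c => (foot ξ α c).im)
    ⟨f, by simp [hf0, h0]⟩
  simp only [Finset.mem_filter, Finset.mem_univ, true_and] at hc hmax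
  have hcu := hξ.upper c
  refine ⟨c, (y - (foot ξ α c).im) / (ξ c).im, div_nonneg (by linarith) hcu.le, ?_, ?_⟩
  · rw [div_le_one hcu]
    by_contra! hlt
    by_cases hlast : ∃ x, α.lt c x
    · obtain ⟨d, hd, -, hd'⟩ := exists_next hlast
      have e : (foot ξ α d).im = (foot ξ α c).im + (ξ c).im := by
        rw [foot_insert ξ hd', Complex.add_im]
      have := hmax d (by linarith)
      linarith
    · have e := foot_add_of_last ξ (not_exists.1 hlast)
      rw [← e, Complex.add_im] at h1
      linarith
  · simp only [Complex.add_im, Complex.im_ofReal_mul]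
    field_simp
    ring

theorem im_snakePoint (hξ : IsZonogonFrame ξ) (hn : 0 < n) (α : LinearOrderOn n) {y : ℝ}
    (h0 : 0 ≤ y) (h1 : y ≤ (∑ x, ξ x).im) : (snakePoint ξ α y).im = y := by
  obtain ⟨c, a, ha0, ha1, hy⟩ := exists_edge hξ hn α h0 h1
  rw [snakePoint_eq hξ α ha0 ha1 hy, hy]

end Frame

end LinearOrderOn

/-! ### The rhombus between two snakes that differ by a flip -/

/-- The horizontal projection of a point of a parallelogram to one of its upper paths. -/
theorem exists_projection {u v : ℂ} (hu : 0 < u.im) (hv : 0 < v.im) {a b : ℝ}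
    (ha : 0 ≤ a ∧ a ≤ 1) (hb : 0 ≤ b ∧ b ≤ 1) :
    ∃ k : ℝ, 0 ≤ k ∧ (0 < b → a < 1 → 0 < k) ∧
      ((∃ t : ℝ, 0 ≤ t ∧ t ≤ 1 ∧ a * u + b * v + (k * wedge u v : ℝ) = t * u) ∨
        ∃ t : ℝ, 0 ≤ t ∧ t ≤ 1 ∧ a * u + b * v + (k * wedge u v : ℝ) = u + t * v) := by
  obtain ⟨ha0, ha1⟩ := ha
  obtain ⟨hb0, hb1⟩ := hb
  -- The target is the point of the path u, then v, at the same height, which determines t and k.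
  -- The sign of `wedge u v` is left free, so exchanging u and v gives the other side of the
  -- rhombus.
  by_cases h : a * u.im + b * v.im ≤ u.im
  · refine ⟨b / u.im, by positivity, fun hb _ => by positivity, Or.inl
      ⟨(a * u.im + b * v.im) / u.im, by positivity, (div_le_one hu).2 h, ?_⟩⟩
    apply Complex.ext
    · simp [wedge]
      field_simp
      ring
    · simp
      field_simp
  · push Not at h
    refine ⟨(1 - a) / v.im, div_nonneg (by linarith) hv.le, fun _ ha => div_pos (by linarith) hv,
      Or.inr ⟨(a * u.im + b * v.im - u.im) / v.im, div_nonneg (by linarith) hv.le, ?_, ?_⟩⟩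
    · rw [div_le_one hv]
      nlinarith
    · apply Complex.ext
      · simp [wedge]
        field_simp
        ring
      · simp
        field_simp
        ring

namespace LinearOrderOn

variable {n : ℕ} {ξ : Fin n → ℂ} {α β : LinearOrderOn n} {i j : Fin n}

namespace IsFlip

/-- The tile swept by a flip. -/
noncomputable def tile (h : IsFlip α β i j) (ξ : Fin n → ℂ) : Tile n :=
  ⟨foot ξ α i, i, j, h.lt⟩

theorem foot_right (h : IsFlip α β i j) (ξ : Fin n → ℂ) : foot ξ α j = foot ξ α i + ξ i :=
  foot_insert ξ h.lt_right_iff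

theorem foot_right' (h : IsFlip α β i j) (ξ : Fin n → ℂ) : foot ξ β j = foot ξ α i :=
  (foot_congr ξ h.lt_left_iff).symm

theorem foot_left' (h : IsFlip α β i j) (ξ : Fin n → ℂ) : foot ξ β i = foot ξ α i + ξ j := by
  rw [foot_insert ξ h.lt_left_iff', h.foot_right']

theorem foot_of_ne (h : IsFlip α β i j) (ξ : Fin n → ℂ) {c : Fin n} (hi : c ≠ i) (hj : c ≠ j) :
    foot ξ α c = foot ξ β c :=
  foot_congr ξ (h.lt_iff_of_ne hi hj)

theorem wedge_neg (h : IsFlip α β i j) (hξ : IsZonogonFrame ξ) : wedge (ξ i) (ξ j) < 0 :=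
  hξ.clockwise i j h.lt

/-- The left boundary of the swept tile lies on the snake of `α`. -/
theorem exists_left (h : IsFlip α β i j) (hξ : IsZonogonFrame ξ) {a b : ℝ}
    (ha : 0 ≤ a ∧ a ≤ 1) (hb : 0 ≤ b ∧ b ≤ 1) {z : ℂ} (hz : z = foot ξ α i + a * ξ i + b * ξ j) :
    ∃ k : ℝ, 0 ≤ k ∧ (0 < b → a < 1 → 0 < k) ∧
      snakePoint ξ α z.im = z + (k * wedge (ξ i) (ξ j) : ℝ) := by
  obtain ⟨k, h1, h2, h3⟩ := exists_projection (hξ.upper i) (hξ.upper j) ha hb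
  refine ⟨k, h1, h2, ?_⟩
  have him : z.im = (z + (k * wedge (ξ i) (ξ j) : ℝ)).im := by
    rw [Complex.add_im, Complex.ofReal_im, add_zero]
  rcases h3 with ⟨t, h4, h5, h6⟩ | ⟨t, h4, h5, h6⟩
  · have e : z + (k * wedge (ξ i) (ξ j) : ℝ) = foot ξ α i + t * ξ i := by
      rw [hz, ← h6]
      ring
    rw [e]
    exact snakePoint_eq hξ α h4 h5 (by rw [him, e])
  · have e : z + (k * wedge (ξ i) (ξ j) : ℝ) = foot ξ α j + t * ξ j := by
      rw [hz, h.foot_right, add_assoc (foot ξ α i) (ξ i), ← h6]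
      ring
    rw [e]
    exact snakePoint_eq hξ α h4 h5 (by rw [him, e])

/-- The right boundary of the swept tile lies on the snake of `β`. -/
theorem exists_right (h : IsFlip α β i j) (hξ : IsZonogonFrame ξ) {a b : ℝ}
    (ha : 0 ≤ a ∧ a ≤ 1) (hb : 0 ≤ b ∧ b ≤ 1) {z : ℂ} (hz : z = foot ξ α i + a * ξ i + b * ξ j) :
    ∃ k : ℝ, 0 ≤ k ∧ (0 < a → b < 1 → 0 < k) ∧
      snakePoint ξ β z.im = z - (k * wedge (ξ i) (ξ j) : ℝ) := by
  obtain ⟨k, h1, h2, h3⟩ := exists_projection (hξ.upper j) (hξ.upper i) hb ha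
  refine ⟨k, h1, h2, ?_⟩
  have hw : (k * wedge (ξ j) (ξ i) : ℝ) = -(k * wedge (ξ i) (ξ j) : ℝ) := by
    simp only [wedge]
    ring
  rw [hw, Complex.ofReal_neg, ← sub_eq_add_neg] at h3
  have him : z.im = (z - (k * wedge (ξ i) (ξ j) : ℝ)).im := by
    rw [Complex.sub_im, Complex.ofReal_im, sub_zero]
  rcases h3 with ⟨t, h4, h5, h6⟩ | ⟨t, h4, h5, h6⟩
  · have e : z - (k * wedge (ξ i) (ξ j) : ℝ) = foot ξ β j + t * ξ j := by
      rw [hz, h.foot_right', ← h6]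
      ring
    rw [e]
    exact snakePoint_eq hξ β h4 h5 (by rw [him, e])
  · have e : z - (k * wedge (ξ i) (ξ j) : ℝ) = foot ξ β i + t * ξ i := by
      rw [hz, h.foot_left', add_assoc (foot ξ α i) (ξ j), ← h6]
      ring
    rw [e]
    exact snakePoint_eq hξ β h4 h5 (by rw [him, e])

theorem re_le_of_mem (h : IsFlip α β i j) (hξ : IsZonogonFrame ξ) {z : ℂ}
    (hz : z ∈ (h.tile ξ).carrier ξ) :
    (snakePoint ξ α z.im).re ≤ z.re ∧ z.re ≤ (snakePoint ξ β z.im).re := by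
  obtain ⟨a, b, ha, hb, hz⟩ := hz
  obtain ⟨k, h1, -, h2⟩ := h.exists_left hξ ha hb hz
  obtain ⟨k', h3, -, h4⟩ := h.exists_right hξ ha hb hz
  have hw := h.wedge_neg hξ
  rw [h2, h4]
  simp only [Complex.add_re, Complex.sub_re, Complex.ofReal_re]
  constructor <;> nlinarith

/-- An edge of the snake of `α` bounds the swept tile or belongs to the snake of `β`. -/
theorem mem_or_eq (h : IsFlip α β i j) (ξ : Fin n → ℂ) {c : Fin n} {a : ℝ}
    (h0 : 0 ≤ a) (h1 : a ≤ 1) :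
    foot ξ α c + a * ξ c ∈ (h.tile ξ).carrier ξ ∨ foot ξ α c = foot ξ β c := by
  by_cases hi : c = i
  · subst hi
    exact Or.inl ⟨a, 0, ⟨h0, h1⟩, ⟨le_rfl, zero_le_one⟩, by simp [tile]⟩
  by_cases hj : c = j
  · subst hj
    exact Or.inl ⟨1, a, ⟨zero_le_one, le_rfl⟩, ⟨h0, h1⟩, by simp [tile, h.foot_right]⟩
  · exact Or.inr (h.foot_of_ne ξ hi hj)

theorem mem_or_eq' (h : IsFlip α β i j) (ξ : Fin n → ℂ) {c : Fin n} {a : ℝ}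
    (h0 : 0 ≤ a) (h1 : a ≤ 1) :
    foot ξ β c + a * ξ c ∈ (h.tile ξ).carrier ξ ∨ foot ξ α c = foot ξ β c := by
  by_cases hi : c = i
  · subst hi
    exact Or.inl ⟨a, 1, ⟨h0, h1⟩, ⟨zero_le_one, le_rfl⟩, by
      simp only [tile, h.foot_left', Complex.ofReal_one]
      ring⟩
  by_cases hj : c = j
  · subst hj
    exact Or.inl ⟨0, a, ⟨le_rfl, zero_le_one⟩, ⟨h0, h1⟩, by simp [tile, h.foot_right']⟩
  · exact Or.inr (h.foot_of_ne ξ hi hj)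

/-- A point of the snake of α lies in the swept rhombus, hence not to the right of the snake of β,
or on an edge common to both snakes. -/
theorem re_snakePoint_le (h : IsFlip α β i j) (hξ : IsZonogonFrame ξ) {y : ℝ}
    (h0 : 0 ≤ y) (h1 : y ≤ (∑ x, ξ x).im) :
    (snakePoint ξ α y).re ≤ (snakePoint ξ β y).re := by
  obtain ⟨c, a, ha0, ha1, hy⟩ := exists_edge hξ (Fin.pos i) α h0 h1
  rw [snakePoint_eq hξ α ha0 ha1 hy]
  rcases h.mem_or_eq ξ (c := c) ha0 ha1 with hm | he
  · rw [hy]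
    exact (h.re_le_of_mem hξ hm).2
  · rw [snakePoint_eq hξ β ha0 ha1 (he ▸ hy), he]

end IsFlip

end LinearOrderOn

theorem Tile.convex_carrier {n : ℕ} (ξ : Fin n → ℂ) (t : Tile n) : Convex ℝ (t.carrier ξ) := by
  rintro _ ⟨a, b, ha, hb, rfl⟩ _ ⟨a', b', ha', hb', rfl⟩ p q hp hq hpq
  refine ⟨p * a + q * a', p * b + q * b', ⟨?_, ?_⟩, ⟨?_, ?_⟩, ?_⟩
  · have := mul_nonneg hp ha.1; have := mul_nonneg hq ha'.1; linarith
  · have := mul_le_mul_of_nonneg_left ha.2 hp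
    have := mul_le_mul_of_nonneg_left ha'.2 hq
    linarith
  · have := mul_nonneg hp hb.1; have := mul_nonneg hq hb'.1; linarith
  · have := mul_le_mul_of_nonneg_left hb.2 hp
    have := mul_le_mul_of_nonneg_left hb'.2 hq
    linarith
  · have : (p : ℂ) + q = 1 := by exact_mod_cast hpq
    simp only [Complex.real_smul]
    push_cast
    linear_combination t.base * this

namespace LinearOrderOn

variable {n : ℕ} {ξ : Fin n → ℂ} {α β : LinearOrderOn n} {i j : Fin n}

/-- A point between the snakes of `α` and `β` lies in the swept tile. -/
theorem IsFlip.mem_tile (h : IsFlip α β i j) (hξ : IsZonogonFrame ξ) {z : ℂ}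
    (h0 : 0 ≤ z.im) (h1 : z.im ≤ (∑ x, ξ x).im)
    (hl : (snakePoint ξ α z.im).re < z.re) (hr : z.re ≤ (snakePoint ξ β z.im).re) :
    z ∈ (h.tile ξ).carrier ξ := by
  -- Both ends of the horizontal chord through z lie in the rhombus: on a common edge the two snakes
  -- would coincide at this height. Convexity then gives z.
  have hα : snakePoint ξ α z.im ∈ (h.tile ξ).carrier ξ := by
    obtain ⟨c, a, ha0, ha1, hy⟩ := exists_edge hξ (Fin.pos i) α h0 h1
    rcases h.mem_or_eq ξ (c := c) ha0 ha1 with hm | he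
    · rwa [snakePoint_eq hξ α ha0 ha1 hy]
    · rw [snakePoint_eq hξ α ha0 ha1 hy, he] at hl
      rw [snakePoint_eq hξ β ha0 ha1 (he ▸ hy)] at hr
      linarith
  have hβ : snakePoint ξ β z.im ∈ (h.tile ξ).carrier ξ := by
    obtain ⟨c, a, ha0, ha1, hy⟩ := exists_edge hξ (Fin.pos i) β h0 h1
    rcases h.mem_or_eq' ξ (c := c) ha0 ha1 with hm | he
    · rwa [snakePoint_eq hξ β ha0 ha1 hy]
    · rw [snakePoint_eq hξ β ha0 ha1 hy, ← he] at hr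
      rw [snakePoint_eq hξ α ha0 ha1 (he.symm ▸ hy)] at hl
      linarith
  have iα := im_snakePoint hξ (Fin.pos i) α h0 h1
  have iβ := im_snakePoint hξ (Fin.pos i) β h0 h1
  generalize snakePoint ξ α z.im = p at *
  generalize snakePoint ξ β z.im = q at *
  have hd : 0 < q.re - p.re := by linarith
  have := (h.tile ξ).convex_carrier ξ hα hβ
    (a := (q.re - z.re) / (q.re - p.re)) (b := (z.re - p.re) / (q.re - p.re))
    (div_nonneg (by linarith) hd.le) (div_nonneg (by linarith) hd.le) (by field_simp; ring)
  convert this using 1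
  apply Complex.ext
  · simp only [Complex.add_re, Complex.smul_re, smul_eq_mul]
    field_simp
    ring
  · simp only [Complex.add_im, Complex.smul_im, smul_eq_mul, iα, iβ]
    field_simp
    ring

/-- A flip strictly moves the interior points of the two edges it involves. -/
theorem IsFlip.lt_re (h : IsFlip α β i j) (hξ : IsZonogonFrame ξ) {c : Fin n} {a : ℝ}
    (h0 : 0 < a) (h1 : a < 1) (hc : c = i ∨ c = j) :
    (foot ξ α c + a * ξ c).re < (snakePoint ξ β (foot ξ α c + a * ξ c).im).re := by
  have hw := h.wedge_neg hξ
  rcases hc with rfl | rfl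
  · obtain ⟨k, -, h3, h4⟩ := h.exists_right hξ (z := foot ξ α c + a * ξ c)
      ⟨h0.le, h1.le⟩ ⟨le_rfl, zero_le_one⟩ (by simp)
    rw [h4, Complex.sub_re, Complex.ofReal_re]
    nlinarith [h3 h0 zero_lt_one]
  · obtain ⟨k, -, h3, h4⟩ := h.exists_right hξ (z := foot ξ α c + a * ξ c)
      ⟨zero_le_one, le_rfl⟩ ⟨h0.le, h1.le⟩ (by simp [h.foot_right])
    rw [h4, Complex.sub_re, Complex.ofReal_re]
    nlinarith [h3 zero_lt_one h1]

theorem IsFlip.lt_re' (h : IsFlip α β i j) (hξ : IsZonogonFrame ξ) {c : Fin n} {a : ℝ}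
    (h0 : 0 < a) (h1 : a < 1) (hc : c = i ∨ c = j) :
    (snakePoint ξ α (foot ξ β c + a * ξ c).im).re < (foot ξ β c + a * ξ c).re := by
  have hw := h.wedge_neg hξ
  rcases hc with rfl | rfl
  · obtain ⟨k, -, h3, h4⟩ := h.exists_left hξ (z := foot ξ β c + a * ξ c)
      ⟨h0.le, h1.le⟩ ⟨zero_le_one, le_rfl⟩ (by rw [h.foot_left', Complex.ofReal_one]; ring)
    rw [h4, Complex.add_re, Complex.ofReal_re]
    nlinarith [h3 zero_lt_one h1]
  · obtain ⟨k, -, h3, h4⟩ := h.exists_left hξ (z := foot ξ β c + a * ξ c)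
      ⟨le_rfl, zero_le_one⟩ ⟨h0.le, h1.le⟩ (by simp [h.foot_right'])
    rw [h4, Complex.add_re, Complex.ofReal_re]
    nlinarith [h3 h0 zero_lt_one]

end LinearOrderOn

/-! ### The boundary of the zonogon, and sweeps from left to right -/

theorem zonogon_im {n : ℕ} {ξ : Fin n → ℂ} (hξ : IsZonogonFrame ξ) {z : ℂ} (hz : z ∈ zonogon ξ) :
    0 ≤ z.im ∧ z.im ≤ (∑ x, ξ x).im := by
  obtain ⟨a, ha, rfl⟩ := hz
  simp only [Complex.im_sum, Complex.im_ofReal_mul]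
  exact ⟨Finset.sum_nonneg fun i _ => mul_nonneg (ha i).1 (hξ.upper i).le,
    Finset.sum_le_sum fun i _ => mul_le_of_le_one_left (hξ.upper i).le (ha i).2⟩

theorem wedge_sum_mul {n : ℕ} (ξ : Fin n → ℂ) (a : Fin n → ℝ) (w : ℂ) :
    wedge (∑ i, (a i : ℂ) * ξ i) w = ∑ i, a i * wedge (ξ i) w := by
  simp only [wedge, Complex.re_sum, Complex.im_sum, Complex.re_ofReal_mul, Complex.im_ofReal_mul,
    Finset.sum_mul, ← Finset.sum_sub_distrib]
  exact Finset.sum_congr rfl fun i _ => by ring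

theorem wedge_self (z : ℂ) : wedge z z = 0 := by
  simp only [wedge]
  ring

theorem wedge_swap (z w : ℂ) : wedge z w = -wedge w z := by
  simp only [wedge]
  ring

namespace LinearOrderOn

variable {n : ℕ} {ξ : Fin n → ℂ}

open Classical in
theorem foot_eq_sum (ξ : Fin n → ℂ) (α : LinearOrderOn n) (c : Fin n) :
    foot ξ α c = ∑ i, ((if α.lt i c then 1 else 0 : ℝ) : ℂ) * ξ i := by
  unfold foot
  refine Finset.sum_congr rfl fun i _ => ?_
  split_ifs <;> simp

/-- The snake of the natural order is the left boundary of the zonogon. -/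
theorem re_natural_le (hξ : IsZonogonFrame ξ) (hn : 0 < n) {z : ℂ} (hz : z ∈ zonogon ξ) :
    (snakePoint ξ (natural n) z.im).re ≤ z.re := by
  classical
  obtain ⟨h0, h1⟩ := zonogon_im hξ hz
  obtain ⟨c, t, ht0, ht1, hy⟩ := exists_edge hξ hn (natural n) h0 h1
  rw [snakePoint_eq hξ _ ht0 ht1 hy]
  have hc := hξ.upper c
  obtain ⟨a, ha, rfl⟩ := hz
  -- The colors before c are those with negative determinant against ξ_c, so this edge minimizes the
  -- functional `wedge · (ξ c)` on the zonogon. At equal heights the functional compares real parts.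
  have key : wedge (foot ξ (natural n) c + t * ξ c) (ξ c)
      ≤ wedge (∑ i, (a i : ℂ) * ξ i) (ξ c) := by
    have : wedge (foot ξ (natural n) c + t * ξ c) (ξ c) = wedge (foot ξ (natural n) c) (ξ c) := by
      simp only [wedge, Complex.add_re, Complex.add_im, Complex.re_ofReal_mul,
        Complex.im_ofReal_mul]
      ring
    rw [this, foot_eq_sum, wedge_sum_mul, wedge_sum_mul]
    refine Finset.sum_le_sum fun i _ => ?_
    rcases lt_trichotomy i c with h | rfl | h
    · have : wedge (ξ i) (ξ c) < 0 := hξ.clockwise i c h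
      rw [if_pos (show (natural n).lt i c from h)]
      nlinarith [(ha i).2]
    · simp [wedge_self]
    · have : wedge (ξ c) (ξ i) < 0 := hξ.clockwise c i h
      rw [wedge_swap] at this
      rw [if_neg (show ¬ (natural n).lt i c from lt_asymm h), zero_mul]
      exact mul_nonneg (ha i).1 (by linarith)
  generalize ∑ i, (a i : ℂ) * ξ i = z at *
  generalize foot ξ (natural n) c + t * ξ c = w at *
  simp only [wedge, hy] at key
  nlinarith

/-- The snake of the reversed natural order is the right boundary of the zonogon. -/
theorem le_re_rev_natural (hξ : IsZonogonFrame ξ) (hn : 0 < n) {z : ℂ} (hz : z ∈ zonogon ξ) :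
    z.re ≤ (snakePoint ξ (natural n).rev z.im).re := by
  classical
  obtain ⟨h0, h1⟩ := zonogon_im hξ hz
  obtain ⟨c, t, ht0, ht1, hy⟩ := exists_edge hξ hn (natural n).rev h0 h1
  rw [snakePoint_eq hξ _ ht0 ht1 hy]
  have hc := hξ.upper c
  obtain ⟨a, ha, rfl⟩ := hz
  have key : wedge (∑ i, (a i : ℂ) * ξ i) (ξ c)
      ≤ wedge (foot ξ (natural n).rev c + t * ξ c) (ξ c) := by
    have : wedge (foot ξ (natural n).rev c + t * ξ c) (ξ c)
        = wedge (foot ξ (natural n).rev c) (ξ c) := by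
      simp only [wedge, Complex.add_re, Complex.add_im, Complex.re_ofReal_mul,
        Complex.im_ofReal_mul]
      ring
    rw [this, foot_eq_sum, wedge_sum_mul, wedge_sum_mul]
    refine Finset.sum_le_sum fun i _ => ?_
    rcases lt_trichotomy i c with h | rfl | h
    · have : wedge (ξ i) (ξ c) < 0 := hξ.clockwise i c h
      rw [if_neg (show ¬ (natural n).rev.lt i c from fun e => lt_asymm h e), zero_mul]
      nlinarith [(ha i).1]
    · simp [wedge_self]
    · have : wedge (ξ c) (ξ i) < 0 := hξ.clockwise c i h
      rw [wedge_swap] at this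
      rw [if_pos (show (natural n).rev.lt i c from h)]
      nlinarith [(ha i).2]
  generalize ∑ i, (a i : ℂ) * ξ i = z at *
  generalize foot ξ (natural n).rev c + t * ξ c = w at *
  simp only [wedge, hy] at key
  nlinarith

theorem IsFlip.tile_subset_zonogon {α β : LinearOrderOn n} {i j : Fin n} (h : IsFlip α β i j)
    (ξ : Fin n → ℂ) : (h.tile ξ).carrier ξ ⊆ zonogon ξ := by
  classical
  rintro _ ⟨a, b, ha, hb, rfl⟩
  refine ⟨fun x => if α.lt x i then 1 else if x = i then a else if x = j then b else 0,
    fun x => ?_, ?_⟩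
  · dsimp only
    split_ifs
    exacts [⟨zero_le_one, le_rfl⟩, ha, hb, ⟨le_rfl, zero_le_one⟩]
  · have : ∀ x, ((if α.lt x i then 1 else if x = i then a else if x = j then b else 0 : ℝ) : ℂ)
        * ξ x = (if α.lt x i then ξ x else 0) + (if x = i then (a : ℂ) * ξ x else 0)
          + if x = j then (b : ℂ) * ξ x else 0 := by
      intro x
      by_cases h1 : α.lt x i
      · have h2 : x ≠ i := ne_of_lt h1
        have h3 : x ≠ j := by
          rintro rfl
          exact α.asymm h.left h1
        simp [h1, h2, h3]
      · by_cases h2 : x = i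
        · subst h2
          simp [h1, h.lt.ne]
        · by_cases h3 : x = j
          · subst h3
            simp [h1, h2]
          · simp [h1, h2, h3]
    simp only [this, Finset.sum_add_distrib]
    simp [tile, foot]

/-- A sequence of flips from the natural order to its reverse. -/
structure IsSweep (c : ℕ → LinearOrderOn n) (N : ℕ) : Prop where
  bot : c 0 = natural n
  top : c N = (natural n).rev
  step : ∀ s < N, ∃ i j, IsFlip (c s) (c (s + 1)) i j

/-- The tiles swept by a sequence of flips. -/
def Swept (ξ : Fin n → ℂ) (c : ℕ → LinearOrderOn n) (N : ℕ) (t : Tile n) : Prop :=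
  ∃ s < N, ∃ i j, ∃ h : IsFlip (c s) (c (s + 1)) i j, t = h.tile ξ

namespace IsSweep

variable {c : ℕ → LinearOrderOn n} {N : ℕ}

theorem mono (hc : IsSweep c N) (hξ : IsZonogonFrame ξ) {y : ℝ} (h0 : 0 ≤ y)
    (h1 : y ≤ (∑ x, ξ x).im) {s r : ℕ} (hsr : s ≤ r) (hr : r ≤ N) :
    (snakePoint ξ (c s) y).re ≤ (snakePoint ξ (c r) y).re := by
  induction r, hsr using Nat.le_induction with
  | base => exact le_rfl
  | succ r hsr ih =>
    obtain ⟨i, j, h⟩ := hc.step r hr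
    exact (ih (Nat.le_of_succ_le hr)).trans (h.re_snakePoint_le hξ h0 h1)

/-- A point shared by two snakes is shared by the snakes between them. -/
theorem snakePoint_eq_of_le (hc : IsSweep c N) (hξ : IsZonogonFrame ξ) (hn : 0 < n) {z : ℂ}
    (h0 : 0 ≤ z.im) (h1 : z.im ≤ (∑ x, ξ x).im) {s r q : ℕ} (hsr : s ≤ r) (hrq : r ≤ q)
    (hq : q ≤ N) (hs : snakePoint ξ (c s) z.im = z) (hq' : snakePoint ξ (c q) z.im = z) :
    snakePoint ξ (c r) z.im = z := by
  apply Complex.ext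
  · have e1 := hc.mono hξ h0 h1 hsr (hrq.trans hq)
    have e2 := hc.mono hξ h0 h1 hrq hq
    rw [hs] at e1
    rw [hq'] at e2
    exact le_antisymm e2 e1
  · exact im_snakePoint hξ hn _ h0 h1

/-- An edge of a snake persists as long as one of its interior points does. -/
theorem foot_eq_of_le (hc : IsSweep c N) (hξ : IsZonogonFrame ξ) {s r : ℕ} (hsr : s ≤ r)
    (hr : r ≤ N) {d : Fin n} {a : ℝ} (ha0 : 0 < a) (ha1 : a < 1) {z : ℂ}
    (h0 : 0 ≤ z.im) (h1 : z.im ≤ (∑ x, ξ x).im)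
    (hz : z = foot ξ (c s) d + a * ξ d) (hz' : snakePoint ξ (c r) z.im = z) :
    foot ξ (c r) d = foot ξ (c s) d := by
  induction r, hsr using Nat.le_induction with
  | base => rfl
  | succ r hsr ih =>
    have hs : snakePoint ξ (c s) z.im = z := by
      rw [hz]
      exact snakePoint_eq hξ _ ha0.le ha1.le rfl
    have hzr := hc.snakePoint_eq_of_le hξ (Fin.pos d) h0 h1 hsr (Nat.le_succ r) hr hs hz'
    have e := ih (Nat.le_of_succ_le hr) hzr
    obtain ⟨i, j, h⟩ := hc.step r hr
    by_cases hd : d = i ∨ d = j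
    · have := h.lt_re hξ ha0 ha1 hd
      rw [e, ← hz, hz'] at this
      exact absurd this (lt_irrefl _)
    · rw [not_or] at hd
      rw [← e, h.foot_of_ne ξ hd.1 hd.2]

theorem foot_eq_of_ge (hc : IsSweep c N) (hξ : IsZonogonFrame ξ) {s r : ℕ} (hsr : s ≤ r)
    (hr : r ≤ N) {d : Fin n} {a : ℝ} (ha0 : 0 < a) (ha1 : a < 1) {z : ℂ}
    (h0 : 0 ≤ z.im) (h1 : z.im ≤ (∑ x, ξ x).im)
    (hz : z = foot ξ (c r) d + a * ξ d) (hz' : snakePoint ξ (c s) z.im = z) :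
    foot ξ (c s) d = foot ξ (c r) d := by
  induction r, hsr using Nat.le_induction with
  | base => rfl
  | succ r hsr ih =>
    have hs : snakePoint ξ (c (r + 1)) z.im = z := by
      rw [hz]
      exact snakePoint_eq hξ _ ha0.le ha1.le rfl
    have hzr := hc.snakePoint_eq_of_le hξ (Fin.pos d) h0 h1 hsr (Nat.le_succ r) hr hz' hs
    obtain ⟨i, j, h⟩ := hc.step r hr
    by_cases hd : d = i ∨ d = j
    · have := h.lt_re' hξ ha0 ha1 hd
      rw [← hz, hzr] at this
      exact absurd this (lt_irrefl _)
    · rw [not_or] at hd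
      have e := h.foot_of_ne ξ hd.1 hd.2
      rw [← e] at hz ⊢
      exact ih (Nat.le_of_succ_le hr) hz

/-- Every edge of a snake of the sweep is an edge of a swept tile. -/
theorem exists_isEdge (hc : IsSweep c N) (hn : 2 ≤ n) (ξ : Fin n → ℂ) {m : ℕ} (hm : m ≤ N)
    (d : Fin n) : ∃ t, Swept ξ c N t ∧ t.IsEdge ξ (foot ξ (c m) d) d := by
  by_contra hno
  -- The first flip involving d on either side of time m would sweep a tile having this edge. If
  -- there is none, the lower set of d never changes, although the two end orders are reversed.
  have up : ∀ r, m ≤ r → r ≤ N → ∀ x, (c r).lt x d ↔ (c m).lt x d := by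
    intro r hmr
    induction r, hmr using Nat.le_induction with
    | base => exact fun _ _ => Iff.rfl
    | succ r hmr ih =>
      intro hr x
      have ih := ih (Nat.le_of_succ_le hr)
      obtain ⟨i, j, h⟩ := hc.step r hr
      have hf := foot_congr ξ ih
      by_cases hi : d = i
      · subst hi
        exact absurd ⟨_, ⟨r, hr, _, _, h, rfl⟩, Or.inl ⟨rfl, Or.inl hf.symm⟩⟩ hno
      by_cases hj : d = j
      · subst hj
        refine absurd ⟨_, ⟨r, hr, _, _, h, rfl⟩, Or.inr ⟨rfl, Or.inr ?_⟩⟩ hno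
        rw [← hf, h.foot_right]
        rfl
      · rw [← h.lt_iff_of_ne hi hj, ih]
  have down : ∀ r, r ≤ m → ∀ x, (c r).lt x d ↔ (c m).lt x d := by
    have aux : ∀ k r, r + k = m → ∀ x, (c r).lt x d ↔ (c m).lt x d := by
      intro k
      induction k with
      | zero => rintro r rfl; exact fun _ => Iff.rfl
      | succ k ih =>
        intro r hr x
        have ih := ih (r + 1) (by omega)
        have hrN : r < N := by omega
        obtain ⟨i, j, h⟩ := hc.step r hrN
        have hf := foot_congr ξ ih
        by_cases hi : d = i
        · subst hi
          refine absurd ⟨_, ⟨r, hrN, _, _, h, rfl⟩, Or.inl ⟨rfl, Or.inr ?_⟩⟩ hno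
          rw [← hf, h.foot_left']
          rfl
        by_cases hj : d = j
        · subst hj
          refine absurd ⟨_, ⟨r, hrN, _, _, h, rfl⟩, Or.inr ⟨rfl, Or.inl ?_⟩⟩ hno
          rw [← hf, h.foot_right']
          rfl
        · rw [h.lt_iff_of_ne hi hj, ih]
    exact fun r hr => aux (m - r) r (by omega)
  have h1 := up N hm le_rfl
  have h2 := down 0 (Nat.zero_le m)
  rw [hc.top] at h1
  rw [hc.bot] at h2
  have h3 : ∀ x : Fin n, x < d ↔ d < x := fun x => (h2 x).trans (h1 x).symm
  have : Nontrivial (Fin n) := Fin.nontrivial_iff_two_le.2 hn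
  obtain ⟨x, hx⟩ := exists_ne d
  rcases lt_or_gt_of_ne hx with h | h
  · exact lt_asymm h ((h3 x).1 h)
  · exact lt_asymm h ((h3 x).2 h)

end IsSweep

end LinearOrderOn

theorem Tile.IsEdge.mem_carrier {n : ℕ} {ξ : Fin n → ℂ} {t : Tile n} {v : ℂ} {c : Fin n}
    (h : t.IsEdge ξ v c) {a : ℝ} (h0 : 0 ≤ a) (h1 : a ≤ 1) : v + a * ξ c ∈ t.carrier ξ := by
  rcases h with ⟨rfl, rfl | rfl⟩ | ⟨rfl, rfl | rfl⟩
  · exact ⟨a, 0, ⟨h0, h1⟩, ⟨le_rfl, zero_le_one⟩, by simp⟩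
  · exact ⟨a, 1, ⟨h0, h1⟩, ⟨zero_le_one, le_rfl⟩, by simp; ring⟩
  · exact ⟨0, a, ⟨le_rfl, zero_le_one⟩, ⟨h0, h1⟩, by simp⟩
  · exact ⟨1, a, ⟨zero_le_one, le_rfl⟩, ⟨h0, h1⟩, by simp⟩

namespace LinearOrderOn

variable {n : ℕ} {ξ : Fin n → ℂ} {c : ℕ → LinearOrderOn n} {N : ℕ}

/-- The swept tiles cover the zonogon. -/
theorem IsSweep.exists_mem (hc : IsSweep c N) (hξ : IsZonogonFrame ξ) (hn : 2 ≤ n) {z : ℂ}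
    (hz : z ∈ zonogon ξ) : ∃ t, Swept ξ c N t ∧ z ∈ t.carrier ξ := by
  classical
  have hn' : 0 < n := by omega
  obtain ⟨h0, h1⟩ := zonogon_im hξ hz
  -- Consider the first snake not to the left of z. If it is the initial one, z lies on the left
  -- boundary; otherwise z lies between consecutive snakes, in the tile swept there.
  have hex : ∃ s, z.re ≤ (snakePoint ξ (c s) z.im).re :=
    ⟨N, by rw [hc.top]; exact le_re_rev_natural hξ hn' hz⟩
  have hN : Nat.find hex ≤ N :=
    Nat.find_min' hex (by rw [hc.top]; exact le_re_rev_natural hξ hn' hz)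
  have hs := Nat.find_spec hex
  rcases hfind : Nat.find hex with _ | s
  · rw [hfind, hc.bot] at hs
    have e : snakePoint ξ (natural n) z.im = z := Complex.ext
      (le_antisymm (re_natural_le hξ hn' hz) hs) (im_snakePoint hξ hn' _ h0 h1)
    obtain ⟨d, a, ha0, ha1, hy⟩ := exists_edge hξ hn' (natural n) h0 h1
    rw [snakePoint_eq hξ _ ha0 ha1 hy] at e
    obtain ⟨t, ht, hd⟩ := hc.exists_isEdge hn ξ (Nat.zero_le N) d
    rw [hc.bot] at hd
    exact ⟨t, ht, e ▸ hd.mem_carrier ha0 ha1⟩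
  · rw [hfind] at hs hN
    have hlt := Nat.find_min hex (m := s) (by omega)
    push Not at hlt
    obtain ⟨i, j, h⟩ := hc.step s hN
    exact ⟨_, ⟨s, hN, i, j, h, rfl⟩, h.mem_tile hξ h0 h1 hlt hs⟩

end LinearOrderOn

/-! ### Swept tiles meet along common vertices and edges -/

namespace Tile

variable {n : ℕ} {ξ : Fin n → ℂ} {t : Tile n} {v : ℂ} {c : Fin n}

theorem IsEdge.isVertex (h : t.IsEdge ξ v c) : t.IsVertex ξ v := by
  rcases h with ⟨rfl, rfl | rfl⟩ | ⟨rfl, rfl | rfl⟩ <;> simp [IsVertex]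

theorem IsEdge.isVertex_add (h : t.IsEdge ξ v c) : t.IsVertex ξ (v + ξ c) := by
  rcases h with ⟨rfl, rfl | rfl⟩ | ⟨rfl, rfl | rfl⟩
  · simp [IsVertex]
  · exact Or.inr (Or.inr (Or.inr (by ring)))
  · simp [IsVertex]
  · simp [IsVertex]

end Tile

theorem mem_segment_add {v w z : ℂ} :
    z ∈ segment ℝ v (v + w) ↔ ∃ a : ℝ, 0 ≤ a ∧ a ≤ 1 ∧ z = v + a * w := by
  rw [segment_eq_image']
  constructor
  · rintro ⟨a, ha, rfl⟩
    exact ⟨a, ha.1, ha.2, by simp⟩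
  · rintro ⟨a, h0, h1, rfl⟩
    exact ⟨a, ⟨h0, h1⟩, by simp⟩

namespace LinearOrderOn

variable {n : ℕ} {ξ : Fin n → ℂ}

namespace IsFlip

variable {α β : LinearOrderOn n} {i j : Fin n}

/-- A convex set of points of the tile that lie on the right snake is contained in an edge. -/
theorem exists_right_edge (h : IsFlip α β i j) (hξ : IsZonogonFrame ξ) {I : Set ℂ}
    (hI : Convex ℝ I) (hsub : I ⊆ (h.tile ξ).carrier ξ)
    (hβ : ∀ z ∈ I, snakePoint ξ β z.im = z) :
    ∃ d, (h.tile ξ).IsEdge ξ (foot ξ β d) d ∧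
      ∀ z ∈ I, ∃ a : ℝ, 0 ≤ a ∧ a ≤ 1 ∧ z = foot ξ β d + a * ξ d := by
  have hw := h.wedge_neg hξ
  have key : ∀ a b : ℝ, 0 ≤ a ∧ a ≤ 1 → 0 ≤ b ∧ b ≤ 1 →
      foot ξ α i + a * ξ i + b * ξ j ∈ I → ¬ (0 < a ∧ b < 1) := by
    rintro a b ha hb hz ⟨h1, h2⟩
    obtain ⟨k, -, h3, h4⟩ := h.exists_right hξ ha hb rfl
    rw [hβ _ hz, eq_comm, sub_eq_self, Complex.ofReal_eq_zero] at h4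
    exact (mul_neg_of_pos_of_neg (h3 h1 h2) hw).ne h4
  -- By `key` every point of I has a = 0 or b = 1. If I contained a point with a = 0, b < 1 and a
  -- point with a > 0, their midpoint would violate `key`.
  by_cases hex : ∃ b : ℝ, 0 ≤ b ∧ b < 1 ∧ foot ξ α i + b * ξ j ∈ I
  · obtain ⟨b₁, h0, h1, hz₁⟩ := hex
    refine ⟨j, Or.inr ⟨rfl, Or.inl (h.foot_right' ξ)⟩, fun z hz => ?_⟩
    obtain ⟨a, b, ha, hb, rfl⟩ := hsub hz
    rcases ha.1.eq_or_lt with rfl | ha0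
    · exact ⟨b, hb.1, hb.2, by simp [tile, h.foot_right']⟩
    · exfalso
      have hm := hI hz₁ hz (a := 1 / 2) (b := 1 / 2) (by norm_num) (by norm_num) (by norm_num)
      refine key (a / 2) ((b₁ + b) / 2) ⟨by linarith, by linarith [ha.2]⟩
        ⟨by linarith [hb.1], by linarith [hb.2]⟩ ?_ ⟨by linarith, by linarith [hb.2]⟩
      convert hm using 1
      simp only [tile, Complex.real_smul]
      push_cast
      ring
  · refine ⟨i, Or.inl ⟨rfl, Or.inr (h.foot_left' ξ)⟩, fun z hz => ?_⟩
    obtain ⟨a, b, ha, hb, rfl⟩ := hsub hz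
    have hb1 : b = 1 := by
      by_contra hne
      have hlt := lt_of_le_of_ne hb.2 hne
      rcases ha.1.eq_or_lt with rfl | ha0
      · exact hex ⟨b, hb.1, hlt, by simpa [tile] using hz⟩
      · exact key a b ha hb hz ⟨ha0, hlt⟩
    subst hb1
    exact ⟨a, ha.1, ha.2, by simp only [tile, h.foot_left', Complex.ofReal_one]; ring⟩

theorem exists_left_edge (h : IsFlip α β i j) (hξ : IsZonogonFrame ξ) {I : Set ℂ}
    (hI : Convex ℝ I) (hsub : I ⊆ (h.tile ξ).carrier ξ)
    (hα : ∀ z ∈ I, snakePoint ξ α z.im = z) :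
    ∃ d, (h.tile ξ).IsEdge ξ (foot ξ α d) d ∧
      ∀ z ∈ I, ∃ a : ℝ, 0 ≤ a ∧ a ≤ 1 ∧ z = foot ξ α d + a * ξ d := by
  have hw := h.wedge_neg hξ
  have key : ∀ a b : ℝ, 0 ≤ a ∧ a ≤ 1 → 0 ≤ b ∧ b ≤ 1 →
      foot ξ α i + a * ξ i + b * ξ j ∈ I → ¬ (0 < b ∧ a < 1) := by
    rintro a b ha hb hz ⟨h1, h2⟩
    obtain ⟨k, -, h3, h4⟩ := h.exists_left hξ ha hb rfl
    rw [hα _ hz, eq_comm, add_eq_left, Complex.ofReal_eq_zero] at h4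
    exact (mul_neg_of_pos_of_neg (h3 h1 h2) hw).ne h4
  by_cases hex : ∃ a : ℝ, 0 ≤ a ∧ a < 1 ∧ foot ξ α i + a * ξ i ∈ I
  · obtain ⟨a₁, h0, h1, hz₁⟩ := hex
    refine ⟨i, Or.inl ⟨rfl, Or.inl rfl⟩, fun z hz => ?_⟩
    obtain ⟨a, b, ha, hb, rfl⟩ := hsub hz
    rcases hb.1.eq_or_lt with rfl | hb0
    · exact ⟨a, ha.1, ha.2, by simp [tile]⟩
    · exfalso
      have hm := hI hz₁ hz (a := 1 / 2) (b := 1 / 2) (by norm_num) (by norm_num) (by norm_num)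
      refine key ((a₁ + a) / 2) (b / 2) ⟨by linarith [ha.1], by linarith [ha.2]⟩
        ⟨by linarith, by linarith [hb.2]⟩ ?_ ⟨by linarith, by linarith [ha.2]⟩
      convert hm using 1
      simp only [tile, Complex.real_smul]
      push_cast
      ring
  · refine ⟨j, Or.inr ⟨rfl, Or.inr (h.foot_right ξ)⟩, fun z hz => ?_⟩
    obtain ⟨a, b, ha, hb, rfl⟩ := hsub hz
    have ha1 : a = 1 := by
      by_contra hne
      have hlt := lt_of_le_of_ne ha.2 hne
      rcases hb.1.eq_or_lt with rfl | hb0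
      · exact hex ⟨a, ha.1, hlt, by simpa [tile] using hz⟩
      · exact key a b ha hb hz ⟨hb0, hlt⟩
    subst ha1
    exact ⟨b, hb.1, hb.2, by simp only [tile, h.foot_right, Complex.ofReal_one]; ring⟩

end IsFlip

/-- An edge of a snake is determined by any of its interior points. -/
theorem eq_of_interior (hξ : IsZonogonFrame ξ) (α : LinearOrderOn n) {c d : Fin n} {a b : ℝ}
    (ha0 : 0 < a) (ha1 : a < 1) (hb0 : 0 ≤ b) (hb1 : b ≤ 1)
    (h : foot ξ α c + a * ξ c = foot ξ α d + b * ξ d) : c = d := by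
  by_contra hne
  have him := congrArg Complex.im h
  simp only [Complex.add_im, Complex.im_ofReal_mul] at him
  have hc := hξ.upper c
  have hd := hξ.upper d
  rcases α.total c d hne with h1 | h1
  · have := im_foot_add_le_of_lt hξ h1
    nlinarith
  · have := im_foot_add_le_of_lt hξ h1
    nlinarith

/-- Two tiles are adjacent or disjoint: if they meet, they meet in a common vertex or in a common
edge. -/
def MeetProperly (ξ : Fin n → ℂ) (t t' : Tile n) : Prop :=
  (∃ v, t.IsVertex ξ v ∧ t'.IsVertex ξ v ∧ t.carrier ξ ∩ t'.carrier ξ = {v}) ∨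
    (∃ v c, t.IsEdge ξ v c ∧ t'.IsEdge ξ v c ∧
      t.carrier ξ ∩ t'.carrier ξ = segment ℝ v (v + ξ c))

theorem MeetProperly.symm {t t' : Tile n} (h : MeetProperly ξ t t') : MeetProperly ξ t' t := by
  unfold MeetProperly
  rw [Set.inter_comm]
  rcases h with ⟨v, h1, h2, h3⟩ | ⟨v, c, h1, h2, h3⟩
  · exact Or.inl ⟨v, h2, h1, h3⟩
  · exact Or.inr ⟨v, c, h2, h1, h3⟩

theorem meetProperly_of_isEdge {t t' : Tile n} {v : ℂ} {c : Fin n} (h : t.IsEdge ξ v c)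
    (h' : t'.IsEdge ξ v c)
    (hI : ∀ z ∈ t.carrier ξ ∩ t'.carrier ξ, ∃ a : ℝ, 0 ≤ a ∧ a ≤ 1 ∧ z = v + a * ξ c) :
    MeetProperly ξ t t' := by
  refine Or.inr ⟨v, c, h, h', Set.Subset.antisymm (fun z hz => mem_segment_add.2 (hI z hz)) ?_⟩
  intro z hz
  obtain ⟨a, h0, h1, rfl⟩ := mem_segment_add.1 hz
  exact ⟨h.mem_carrier h0 h1, h'.mem_carrier h0 h1⟩

/-- The snakes s + 1 and r run between the two tiles, so they pass through every common point. The
intersection is convex, hence inside one right edge of the earlier tile and one left edge of the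
later one. If it contains an interior point of either edge, that edge persists from one snake to the
other, the edges coincide, and they are the whole intersection. Otherwise only ends remain, and
convexity leaves a single vertex. -/
theorem IsSweep.meetProperly {c : ℕ → LinearOrderOn n} {N : ℕ} (hc : IsSweep c N)
    (hξ : IsZonogonFrame ξ) {s r : ℕ} (hsr : s < r) (hr : r < N) {i j k l : Fin n}
    (h : IsFlip (c s) (c (s + 1)) i j) (h' : IsFlip (c r) (c (r + 1)) k l)
    (hne : ((h.tile ξ).carrier ξ ∩ (h'.tile ξ).carrier ξ).Nonempty) :
    MeetProperly ξ (h.tile ξ) (h'.tile ξ) := by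
  set I := (h.tile ξ).carrier ξ ∩ (h'.tile ξ).carrier ξ with hIdef
  have hIZ : ∀ z ∈ I, 0 ≤ z.im ∧ z.im ≤ (∑ x, ξ x).im :=
    fun z hz => zonogon_im hξ (h.tile_subset_zonogon ξ hz.1)
  have hI : Convex ℝ I := ((h.tile ξ).convex_carrier ξ).inter ((h'.tile ξ).convex_carrier ξ)
  have hn : 0 < n := Fin.pos i
  have both : ∀ z ∈ I, snakePoint ξ (c (s + 1)) z.im = z ∧ snakePoint ξ (c r) z.im = z := by
    intro z hz
    have h1 := (h.re_le_of_mem hξ hz.1).2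
    have h2 := (h'.re_le_of_mem hξ hz.2).1
    have h3 := hc.mono hξ (hIZ z hz).1 (hIZ z hz).2 (Nat.succ_le_of_lt hsr) hr.le
    exact ⟨Complex.ext (by linarith) (im_snakePoint hξ hn _ (hIZ z hz).1 (hIZ z hz).2),
      Complex.ext (by linarith) (im_snakePoint hξ hn _ (hIZ z hz).1 (hIZ z hz).2)⟩
  obtain ⟨d, hd, hId⟩ := h.exists_right_edge hξ hI Set.inter_subset_left fun z hz => (both z hz).1
  obtain ⟨d', hd', hId'⟩ :=
    h'.exists_left_edge hξ hI Set.inter_subset_right fun z hz => (both z hz).2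
  by_cases hopen : ∃ z ∈ I, ∃ a : ℝ, 0 < a ∧ a < 1 ∧ z = foot ξ (c (s + 1)) d + a * ξ d
  · obtain ⟨z, hz, a, ha0, ha1, hza⟩ := hopen
    have e := hc.foot_eq_of_le hξ (Nat.succ_le_of_lt hsr) hr.le ha0 ha1 (hIZ z hz).1 (hIZ z hz).2
      hza (both z hz).2
    obtain ⟨b, hb0, hb1, hzb⟩ := hId' z hz
    have e' := eq_of_interior hξ (c r) ha0 ha1 hb0 hb1 (by rw [← hzb, e, ← hza])
    subst e'
    rw [e] at hd'
    exact meetProperly_of_isEdge hd hd' hId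
  by_cases hopen' : ∃ z ∈ I, ∃ a : ℝ, 0 < a ∧ a < 1 ∧ z = foot ξ (c r) d' + a * ξ d'
  · obtain ⟨z, hz, a, ha0, ha1, hza⟩ := hopen'
    have e := hc.foot_eq_of_ge hξ (Nat.succ_le_of_lt hsr) hr.le ha0 ha1 (hIZ z hz).1 (hIZ z hz).2
      hza (both z hz).1
    obtain ⟨b, hb0, hb1, hzb⟩ := hId z hz
    have e' := eq_of_interior hξ (c (s + 1)) ha0 ha1 hb0 hb1 (by rw [← hzb, e, ← hza])
    subst e'
    rw [e] at hd
    exact meetProperly_of_isEdge hd hd' hId'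
  have hend : ∀ z ∈ I, z = foot ξ (c (s + 1)) d ∨ z = foot ξ (c (s + 1)) d + ξ d := by
    intro z hz
    obtain ⟨a, h0, h1, hza⟩ := hId z hz
    rcases h0.eq_or_lt with rfl | h0
    · exact Or.inl (by simpa using hza)
    rcases h1.eq_or_lt with rfl | h1
    · exact Or.inr (by simpa using hza)
    exact absurd ⟨z, hz, a, h0, h1, hza⟩ hopen
  obtain ⟨z, hz⟩ := hne
  have hv : (h.tile ξ).IsVertex ξ z := by
    rcases hend z hz with e | e <;> rw [e]
    exacts [hd.isVertex, hd.isVertex_add]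
  have hv' : (h'.tile ξ).IsVertex ξ z := by
    obtain ⟨a, h0, h1, hza⟩ := hId' z hz
    rcases h0.eq_or_lt with rfl | h0
    · rw [show z = foot ξ (c r) d' by simpa using hza]
      exact hd'.isVertex
    rcases h1.eq_or_lt with rfl | h1
    · rw [show z = foot ξ (c r) d' + ξ d' by simpa using hza]
      exact hd'.isVertex_add
    exact absurd ⟨z, hz, a, h0, h1, hza⟩ hopen'
  have mid : ∀ p ∈ I, ∀ q ∈ I, p = foot ξ (c (s + 1)) d → q = foot ξ (c (s + 1)) d + ξ d →
      False := by
    intro p hp q hq h1 h2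
    refine hopen ⟨_, hI hp hq (a := 1 / 2) (b := 1 / 2) (by norm_num) (by norm_num) (by norm_num),
      1 / 2, by norm_num, by norm_num, ?_⟩
    rw [h1, h2]
    simp only [Complex.real_smul]
    push_cast
    ring
  refine Or.inl ⟨z, hv, hv', Set.eq_singleton_iff_unique_mem.2 ⟨hz, fun w hw => ?_⟩⟩
  rcases hend z hz with e | e <;> rcases hend w hw with e' | e'
  · rw [e, e']
  · exact (mid z hz w hw e e').elim
  · exact (mid w hw z hz e' e).elim
  · rw [e, e']

theorem IsFlip.unique {α β : LinearOrderOn n} {i j k l : Fin n} (h : IsFlip α β i j)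
    (h' : IsFlip α β k l) : k = i ∧ l = j := by
  by_contra hne
  refine α.asymm h'.left ((h.agree l k ?_ ?_).2 h'.right)
  · rintro rfl rfl
    exact lt_asymm h.lt h'.lt
  · rintro rfl rfl
    exact hne ⟨rfl, rfl⟩

theorem Swept.finite (ξ : Fin n → ℂ) (c : ℕ → LinearOrderOn n) (N : ℕ) :
    {t | Swept ξ c N t}.Finite := by
  refine (Set.finite_range fun p : Fin N × {q : Fin n × Fin n // q.1 < q.2} =>
    (⟨foot ξ (c p.1) p.2.1.1, p.2.1.1, p.2.1.2, p.2.2⟩ : Tile n)).subset ?_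
  rintro _ ⟨s, hs, i, j, h, rfl⟩
  exact ⟨(⟨s, hs⟩, ⟨(i, j), h.lt⟩), rfl⟩

/-- The tiles swept by a sequence of flips form a rhombus tiling. -/
noncomputable def IsSweep.tiling {c : ℕ → LinearOrderOn n} {N : ℕ} (hc : IsSweep c N)
    (hξ : IsZonogonFrame ξ) (hn : 2 ≤ n) : RhombusTiling ξ where
  tiles := (Swept.finite ξ c N).toFinset
  cover := by
    refine Set.Subset.antisymm (Set.iUnion₂_subset fun t ht => ?_) fun z hz => ?_
    · obtain ⟨s, hs, i, j, h, rfl⟩ := (Swept.finite ξ c N).mem_toFinset.1 ht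
      exact h.tile_subset_zonogon ξ
    · obtain ⟨t, ht, hzt⟩ := hc.exists_mem hξ hn hz
      exact Set.mem_iUnion₂.2 ⟨t, (Swept.finite ξ c N).mem_toFinset.2 ht, hzt⟩
  inter := by
    intro t ht t' ht' hne hnonempty
    obtain ⟨s, hs, i, j, h, rfl⟩ := (Swept.finite ξ c N).mem_toFinset.1 ht
    obtain ⟨r, hr, k, l, h', rfl⟩ := (Swept.finite ξ c N).mem_toFinset.1 ht'
    rcases lt_trichotomy s r with hsr | rfl | hsr
    · exact hc.meetProperly hξ hsr hr h h' hnonempty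
    · obtain ⟨rfl, rfl⟩ := h.unique h'
      exact absurd rfl hne
    · exact (hc.meetProperly hξ hsr hs h' h (Set.inter_comm _ _ ▸ hnonempty)).symm

end LinearOrderOn

/-! ### Local geometry of an arbitrary tiling -/

theorem coeff_unique {u v : ℂ} (huv : wedge u v ≠ 0) {a b a' b' : ℝ}
    (h : (a : ℂ) * u + b * v = a' * u + b' * v) : a = a' ∧ b = b' := by
  have h1 := congrArg Complex.re h
  have h2 := congrArg Complex.im h
  simp only [Complex.add_re, Complex.add_im, Complex.re_ofReal_mul, Complex.im_ofReal_mul] at h1 h2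
  unfold wedge at huv
  constructor
  · apply mul_right_cancel₀ huv
    linear_combination v.im * h1 - v.re * h2
  · apply mul_right_cancel₀ huv
    linear_combination u.re * h2 - u.im * h1

theorem convex_zonogon {n : ℕ} (ξ : Fin n → ℂ) : Convex ℝ (zonogon ξ) := by
  rintro _ ⟨a, ha, rfl⟩ _ ⟨b, hb, rfl⟩ p q hp hq hpq
  refine ⟨fun i => p * a i + q * b i, fun i => ⟨?_, ?_⟩, ?_⟩
  · have := mul_nonneg hp (ha i).1; have := mul_nonneg hq (hb i).1; linarith
  · have := mul_le_mul_of_nonneg_left (ha i).2 hp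
    have := mul_le_mul_of_nonneg_left (hb i).2 hq
    linarith
  · simp only [Complex.real_smul, Finset.mul_sum, ← Finset.sum_add_distrib]
    refine Finset.sum_congr rfl fun i _ => ?_
    push_cast
    ring

namespace Tile

variable {n : ℕ} {ξ : Fin n → ℂ} {t : Tile n} {v : ℂ} {c : Fin n}

theorem wedge_neg (hξ : IsZonogonFrame ξ) (t : Tile n) : wedge (ξ t.i) (ξ t.j) < 0 :=
  hξ.clockwise _ _ t.hij

theorem coeff_unique (hξ : IsZonogonFrame ξ) (t : Tile n) {a b a' b' : ℝ}
    (h : t.base + a * ξ t.i + b * ξ t.j = t.base + a' * ξ t.i + b' * ξ t.j) : a = a' ∧ b = b' :=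
  _root_.coeff_unique (t.wedge_neg hξ).ne (by linear_combination h)

theorem IsVertex.exists_coeff (h : t.IsVertex ξ v) :
    ∃ a b : ℝ, (a = 0 ∨ a = 1) ∧ (b = 0 ∨ b = 1) ∧ v = t.base + a * ξ t.i + b * ξ t.j := by
  rcases h with rfl | rfl | rfl | rfl
  · exact ⟨0, 0, by simp⟩
  · exact ⟨1, 0, by simp⟩
  · exact ⟨0, 1, by simp⟩
  · exact ⟨1, 1, by simp⟩

theorem isEdge_iff : t.IsEdge ξ v c ↔
    (c = t.i ∧ ∃ b : ℝ, (b = 0 ∨ b = 1) ∧ v = t.base + b * ξ t.j) ∨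
      (c = t.j ∧ ∃ a : ℝ, (a = 0 ∨ a = 1) ∧ v = t.base + a * ξ t.i) := by
  unfold IsEdge
  simp [or_and_right, exists_or]

theorem isCompact_carrier (ξ : Fin n → ℂ) (t : Tile n) : IsCompact (t.carrier ξ) := by
  have : t.carrier ξ = (fun p : ℝ × ℝ => t.base + (p.1 : ℂ) * ξ t.i + (p.2 : ℂ) * ξ t.j) ''
      (Set.Icc 0 1 ×ˢ Set.Icc 0 1) := by
    ext z
    constructor
    · rintro ⟨a, b, ha, hb, rfl⟩
      exact ⟨(a, b), ⟨ha, hb⟩, rfl⟩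
    · rintro ⟨p, hp, rfl⟩
      exact ⟨p.1, p.2, hp.1, hp.2, rfl⟩
  rw [this]
  exact (isCompact_Icc.prod isCompact_Icc).image (by fun_prop)

/-- An interior point of an edge is not a vertex. -/
theorem IsEdge.not_isVertex (hξ : IsZonogonFrame ξ) (h : t.IsEdge ξ v c) {a : ℝ} (h0 : 0 < a)
    (h1 : a < 1) : ¬ t.IsVertex ξ (v + a * ξ c) := by
  intro hv
  obtain ⟨x, y, hx, hy, e⟩ := hv.exists_coeff
  rcases isEdge_iff.1 h with ⟨rfl, b, hb, rfl⟩ | ⟨rfl, b, hb, rfl⟩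
  · have := (t.coeff_unique hξ (a := a) (b := b) (a' := x) (b' := y)
      (by rw [← e]; ring)).1
    rcases hx with rfl | rfl <;> linarith
  · have := (t.coeff_unique hξ (a := b) (b := a) (a' := x) (b' := y) e).2
    rcases hy with rfl | rfl <;> linarith

/-- An interior point of an edge belongs to no other edge. -/
theorem IsEdge.unique (hξ : IsZonogonFrame ξ) (h : t.IsEdge ξ v c) {w : ℂ} {d : Fin n}
    (h' : t.IsEdge ξ w d) {a b : ℝ} (h0 : 0 < a) (h1 : a < 1)
    (e : v + a * ξ c = w + b * ξ d) : w = v ∧ d = c := by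
  rcases isEdge_iff.1 h with ⟨rfl, x, hx, rfl⟩ | ⟨rfl, x, hx, rfl⟩ <;>
    rcases isEdge_iff.1 h' with ⟨rfl, y, hy, rfl⟩ | ⟨rfl, y, hy, rfl⟩
  · have := (t.coeff_unique hξ (a := a) (b := x) (a' := b) (b' := y)
      (by linear_combination e)).2
    rw [this]
    exact ⟨rfl, rfl⟩
  · have := (t.coeff_unique hξ (a := a) (b := x) (a' := y) (b' := b)
      (by linear_combination e)).1
    rcases hy with rfl | rfl <;> linarith
  · have := (t.coeff_unique hξ (a := x) (b := a) (a' := b) (b' := y)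
      (by linear_combination e)).2
    rcases hy with rfl | rfl <;> linarith
  · have := (t.coeff_unique hξ (a := x) (b := a) (a' := y) (b' := b) e).1
    rw [this]
    exact ⟨rfl, rfl⟩

/-- The left vertex of a tile can be moved to the right inside the tile. -/
theorem exists_right_of_left_vertex (hξ : IsZonogonFrame ξ) (t : Tile n) :
    ∃ δ : ℝ, 0 < δ ∧ t.base + ξ t.i + (δ : ℂ) ∈ t.carrier ξ := by
  have hw := t.wedge_neg hξ
  have hi := hξ.upper t.i
  have hj := hξ.upper t.j
  have hs : 0 < (ξ t.i).im + (ξ t.j).im := by linarith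
  -- The horizontal line through the left vertex is followed up to the diagonal from the bottom to
  -- the top of the tile, where both coefficients are equal.
  refine ⟨-wedge (ξ t.i) (ξ t.j) / ((ξ t.i).im + (ξ t.j).im), div_pos (by linarith) hs,
    1 - (ξ t.j).im / ((ξ t.i).im + (ξ t.j).im), (ξ t.i).im / ((ξ t.i).im + (ξ t.j).im),
    ⟨?_, ?_⟩, ⟨by positivity, ?_⟩, ?_⟩
  · rw [sub_nonneg, div_le_one hs]; linarith
  · rw [sub_le_self_iff]; positivity
  · rw [div_le_one hs]; linarith
  · apply Complex.ext
    · simp only [wedge, Complex.add_re, Complex.re_ofReal_mul, Complex.ofReal_re]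
      field_simp
      ring
    · simp only [Complex.add_im, Complex.im_ofReal_mul, Complex.ofReal_im]
      field_simp
      ring

/-- If an edge has a point of the tile to its right, it is a left edge of the tile. -/
theorem IsEdge.left (hξ : IsZonogonFrame ξ) (h : t.IsEdge ξ v c) {a δ : ℝ} (hδ : 0 < δ)
    (hp : v + a * ξ c + (δ : ℂ) ∈ t.carrier ξ) :
    (t.i = c ∧ t.base = v) ∨ (t.j = c ∧ v = t.base + ξ t.i) := by
  have hw := t.wedge_neg hξ
  have hi := hξ.upper t.i
  have hj := hξ.upper t.j
  obtain ⟨x, y, hx, hy, e⟩ := hp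
  have e1 := congrArg Complex.re e
  have e2 := congrArg Complex.im e
  rcases h with ⟨rfl, rfl | rfl⟩ | ⟨rfl, rfl | rfl⟩
  · exact Or.inl ⟨rfl, rfl⟩
  · exfalso
    simp only [Complex.add_re, Complex.add_im, Complex.re_ofReal_mul, Complex.im_ofReal_mul,
      Complex.ofReal_re, Complex.ofReal_im] at e1 e2
    have : -(ξ t.i).im * δ = (y - 1) * wedge (ξ t.i) (ξ t.j) := by
      unfold wedge
      linear_combination (ξ t.i).re * e2 - (ξ t.i).im * e1
    nlinarith [hy.2, mul_pos hi hδ]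
  · exfalso
    simp only [Complex.add_re, Complex.add_im, Complex.re_ofReal_mul, Complex.im_ofReal_mul,
      Complex.ofReal_re, Complex.ofReal_im] at e1 e2
    have : (ξ t.j).im * δ = x * wedge (ξ t.i) (ξ t.j) := by
      unfold wedge
      linear_combination (ξ t.j).im * e1 - (ξ t.j).re * e2
    nlinarith [hx.1, mul_pos hj hδ]
  · exact Or.inr ⟨rfl, rfl⟩

end Tile

namespace RhombusTiling

variable {n : ℕ} {ξ : Fin n → ℂ} (T : RhombusTiling ξ)

theorem subset_zonogon {t : Tile n} (ht : t ∈ T.tiles) : t.carrier ξ ⊆ zonogon ξ := by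
  rw [← T.cover]
  exact Set.subset_biUnion_of_mem (u := fun t : Tile n => t.carrier ξ) ht

/-- Distinct tiles do not contain a common horizontal segment. -/
theorem eq_of_horizontal (hξ : IsZonogonFrame ξ) {t t' : Tile n} (ht : t ∈ T.tiles)
    (ht' : t' ∈ T.tiles) {q : ℂ} {δ : ℝ} (hδ : 0 < δ) (h1 : q ∈ t.carrier ξ)
    (h2 : q ∈ t'.carrier ξ) (h3 : q + (δ : ℂ) ∈ t.carrier ξ) (h4 : q + (δ : ℂ) ∈ t'.carrier ξ) :
    t = t' := by
  by_contra hne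
  rcases T.inter t ht t' ht' hne ⟨q, h1, h2⟩ with ⟨v, -, -, hI⟩ | ⟨v, c, -, -, hI⟩
  · have e1 : q = v := hI.subset ⟨h1, h2⟩
    have e2 : q + (δ : ℂ) = v := hI.subset ⟨h3, h4⟩
    rw [← e1, add_eq_left, Complex.ofReal_eq_zero] at e2
    exact hδ.ne' e2
  · obtain ⟨a, -, -, e1⟩ := mem_segment_add.1 (hI.subset ⟨h1, h2⟩)
    obtain ⟨b, -, -, e2⟩ := mem_segment_add.1 (hI.subset ⟨h3, h4⟩)
    have hab : (b - a) * (ξ c).im = 0 := by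
      have := congrArg Complex.im (e2.symm.trans (congrArg (· + (δ : ℂ)) e1))
      simp only [Complex.add_im, Complex.im_ofReal_mul, Complex.ofReal_im] at this
      linear_combination this
    rcases mul_eq_zero.1 hab with h | h
    · have hab : b = a := by linarith
      rw [hab, ← e1, add_eq_left, Complex.ofReal_eq_zero] at e2
      exact hδ.ne' e2
    · exact (hξ.upper c).ne' h

/-- A tile containing an interior point of an edge of the tiling has this edge. -/
theorem isEdge_of_mem (hξ : IsZonogonFrame ξ) {v : ℂ} {c : Fin n} (h : T.IsEdge v c)
    {t : Tile n} (ht : t ∈ T.tiles) {a : ℝ} (h0 : 0 < a) (h1 : a < 1)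
    (hp : v + a * ξ c ∈ t.carrier ξ) : t.IsEdge ξ v c := by
  obtain ⟨t', ht', he⟩ := h
  have hp' := he.mem_carrier h0.le h1.le
  by_cases hne : t' = t
  · exact hne ▸ he
  rcases T.inter t' ht' t ht hne ⟨_, hp', hp⟩ with ⟨w, hw, -, hI⟩ | ⟨w, d, hw, hw', hI⟩
  · have e : v + a * ξ c = w := hI.subset ⟨hp', hp⟩
    exact absurd (e ▸ hw) (he.not_isVertex hξ h0 h1)
  · obtain ⟨b, -, -, e⟩ := mem_segment_add.1 (hI.subset ⟨hp', hp⟩)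
    obtain ⟨rfl, rfl⟩ := he.unique hξ hw h0 h1 e
    exact hw'

/-- A tile containing the center of a tile of the tiling is this tile. -/
theorem eq_of_center_mem (hξ : IsZonogonFrame ξ) {t t' : Tile n} (ht : t ∈ T.tiles)
    (ht' : t' ∈ T.tiles)
    (h : t.base + ((1 / 2 : ℝ) : ℂ) * ξ t.i + ((1 / 2 : ℝ) : ℂ) * ξ t.j ∈ t'.carrier ξ) :
    t = t' := by
  by_contra hne
  have hm : t.base + ((1 / 2 : ℝ) : ℂ) * ξ t.i + ((1 / 2 : ℝ) : ℂ) * ξ t.j ∈ t.carrier ξ :=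
    ⟨1 / 2, 1 / 2, by norm_num, by norm_num, rfl⟩
  rcases T.inter t ht t' ht' hne ⟨_, hm, h⟩ with ⟨v, hv, -, hI⟩ | ⟨v, c, hv, -, hI⟩
  · have e := hI.subset ⟨hm, h⟩
    obtain ⟨x, y, hx, -, e'⟩ := hv.exists_coeff
    have := (t.coeff_unique hξ (Set.mem_singleton_iff.1 e |>.trans e')).1
    rcases hx with rfl | rfl <;> norm_num at this
  · obtain ⟨b, -, -, e⟩ := mem_segment_add.1 (hI.subset ⟨hm, h⟩)
    rcases Tile.isEdge_iff.1 hv with ⟨rfl, x, hx, rfl⟩ | ⟨rfl, x, hx, rfl⟩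
    · have := (t.coeff_unique hξ (a := 1 / 2) (b := 1 / 2) (a' := b) (b' := x)
        (by linear_combination e)).2
      rcases hx with rfl | rfl <;> norm_num at this
    · have := (t.coeff_unique hξ (a' := x) (b' := b) e).1
      rcases hx with rfl | rfl <;> norm_num at this

/-- Some tile extends to the right of a given point, unless the zonogon does not. -/
theorem exists_right {p : ℂ} (hp : p ∈ zonogon ξ) {δ : ℝ} (hδ : 0 < δ)
    (hpδ : p + (δ : ℂ) ∈ zonogon ξ) :
    ∃ t ∈ T.tiles, p ∈ t.carrier ξ ∧ ∃ ε : ℝ, 0 < ε ∧ p + (ε : ℂ) ∈ t.carrier ξ := by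
  by_contra! hno
  -- Tiles through p do not extend to the right, and the others are closed and miss p. As there are
  -- finitely many, p + ε would be uncovered for some small ε although it lies in the zonogon.
  have hev : ∀ t ∈ T.tiles, ∀ᶠ ε : ℝ in nhdsWithin 0 (Set.Ioi 0), p + (ε : ℂ) ∉ t.carrier ξ := by
    intro t ht
    by_cases hpt : p ∈ t.carrier ξ
    · filter_upwards [self_mem_nhdsWithin] with ε hε
      exact hno t ht hpt ε hε
    · have hc : Filter.Tendsto (fun ε : ℝ => p + (ε : ℂ)) (nhdsWithin 0 (Set.Ioi 0)) (nhds p) := by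
        have : Continuous fun ε : ℝ => p + (ε : ℂ) := by fun_prop
        simpa using (this.tendsto 0).mono_left nhdsWithin_le_nhds
      exact hc.eventually ((t.isCompact_carrier ξ).isClosed.isOpen_compl.mem_nhds hpt)
  have hall := (Filter.eventually_all_finset T.tiles).2 hev
  have hsmall : ∀ᶠ ε : ℝ in nhdsWithin 0 (Set.Ioi 0), ε ∈ Set.Ioo 0 δ := Ioo_mem_nhdsGT hδ
  obtain ⟨ε, h1, h2⟩ := (hall.and hsmall).exists
  have hz : p + (ε : ℂ) ∈ zonogon ξ := by
    have := convex_zonogon ξ hp hpδ (a := 1 - ε / δ) (b := ε / δ)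
      (by rw [sub_nonneg, div_le_one hδ]; exact h2.2.le) (div_nonneg h2.1.le hδ.le) (by ring)
    convert this using 1
    have hδ' : (δ : ℂ) ≠ 0 := by exact_mod_cast hδ.ne'
    simp only [Complex.real_smul]
    push_cast
    field_simp
    ring
  rw [← T.cover] at hz
  obtain ⟨t, ht, hzt⟩ := Set.mem_iUnion₂.1 hz
  exact h1 t ht hzt

end RhombusTiling

/-! ### Flipping a snake of a tiling towards the right boundary -/

open LinearOrderOn

namespace RhombusTiling

variable {n : ℕ} {ξ : Fin n → ℂ}

/-- An edge going up from the left vertex of a tile does not enter the tile. -/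
theorem le_of_isEdge_left_vertex (T : RhombusTiling ξ) (hξ : IsZonogonFrame ξ) {t : Tile n}
    (ht : t ∈ T.tiles) {c : Fin n} (h : T.IsEdge (t.base + ξ t.i) c) : c ≤ t.j := by
  by_contra! hlt
  have w1 : wedge (ξ t.i) (ξ t.j) < 0 := hξ.clockwise _ _ t.hij
  have w2 : wedge (ξ t.j) (ξ c) < 0 := hξ.clockwise _ _ hlt
  have w3 : wedge (ξ t.i) (ξ c) < 0 := hξ.clockwise _ _ (t.hij.trans hlt)
  have hs : wedge (ξ t.i) (ξ t.j) + wedge (ξ t.j) (ξ c) + wedge (ξ t.i) (ξ c) < 0 := by linarith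
  -- With w₁, w₂, w₃ the determinants of (i, j), (j, c), (i, c), Cramer's rule gives w₁ ξ_c = w₃ ξ_j
  -- − w₂ ξ_i. Dividing by the sum of the three negative numbers yields a point inside the edge that
  -- still lies in the tile.
  set s := wedge (ξ t.i) (ξ t.j) / (wedge (ξ t.i) (ξ t.j) + wedge (ξ t.j) (ξ c)
    + wedge (ξ t.i) (ξ c)) with hsdef
  have hmem : t.base + ξ t.i + (s : ℂ) * ξ c ∈ t.carrier ξ := by
    refine ⟨1 - wedge (ξ t.j) (ξ c) / (wedge (ξ t.i) (ξ t.j) + wedge (ξ t.j) (ξ c)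
      + wedge (ξ t.i) (ξ c)), wedge (ξ t.i) (ξ c) / (wedge (ξ t.i) (ξ t.j) + wedge (ξ t.j) (ξ c)
      + wedge (ξ t.i) (ξ c)), ⟨?_, ?_⟩, ⟨?_, ?_⟩, ?_⟩
    · rw [sub_nonneg, div_le_one_of_neg hs]; linarith
    · rw [sub_le_self_iff]; exact (div_pos_of_neg_of_neg w2 hs).le
    · exact (div_pos_of_neg_of_neg w3 hs).le
    · rw [div_le_one_of_neg hs]; linarith
    · apply Complex.ext
      · simp only [hsdef, Complex.add_re, Complex.re_ofReal_mul]
        field_simp [hs.ne]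
        simp only [wedge]
        ring
      · simp only [hsdef, Complex.add_im, Complex.im_ofReal_mul]
        field_simp [hs.ne]
        simp only [wedge]
        ring
  have hs1 : s < 1 := by rw [hsdef, div_lt_one_of_neg hs]; linarith
  have he := T.isEdge_of_mem hξ h ht (div_pos_of_neg_of_neg w1 hs) hs1 hmem
  rcases he with ⟨e, -⟩ | ⟨e, -⟩
  · exact absurd (e ▸ hlt) (not_lt_of_gt t.hij)
  · exact hlt.ne' e

/-- An edge of the tiling with room to its right is the lower left edge of a tile, or its lower
end is the left vertex of a tile. -/
theorem exists_lower_left (T : RhombusTiling ξ) (hξ : IsZonogonFrame ξ) {v : ℂ} {c d : Fin n}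
    (h : T.IsEdge v c) (hcd : c < d) (hv : v + ξ d ∈ zonogon ξ) :
    ∃ t ∈ T.tiles, (t.i = c ∧ t.base = v) ∨ (t.j = c ∧ v = t.base + ξ t.i) := by
  have hc := hξ.upper c
  have hd := hξ.upper d
  have hw : wedge (ξ c) (ξ d) < 0 := hξ.clockwise c d hcd
  have hs : 0 < (ξ c).im + (ξ d).im := by linarith
  have hcZ : ∀ a : ℝ, 0 ≤ a → a ≤ 1 → v + a * ξ c ∈ zonogon ξ := by
    intro a h0 h1
    obtain ⟨t, ht, he⟩ := h
    exact T.subset_zonogon ht (he.mem_carrier h0 h1)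
  have h0 : v ∈ zonogon ξ := by simpa using hcZ 0 le_rfl zero_le_one
  -- This fraction of ξ_c and the complementary fraction of ξ_d have the same height, so the two
  -- points above v bound a horizontal segment in the zonogon, to the right of the edge.
  have ha0 : 0 < (ξ d).im / ((ξ c).im + (ξ d).im) := by positivity
  have ha1 : (ξ d).im / ((ξ c).im + (ξ d).im) < 1 := by rw [div_lt_one hs]; linarith
  have hp := hcZ _ ha0.le ha1.le
  have hδ : 0 < -wedge (ξ c) (ξ d) / ((ξ c).im + (ξ d).im) := div_pos (by linarith) hs
  have hpδ : v + (((ξ d).im / ((ξ c).im + (ξ d).im) : ℝ) : ℂ) * ξ c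
      + ((-wedge (ξ c) (ξ d) / ((ξ c).im + (ξ d).im) : ℝ) : ℂ) ∈ zonogon ξ := by
    have := convex_zonogon ξ h0 hv (a := (ξ d).im / ((ξ c).im + (ξ d).im))
      (b := (ξ c).im / ((ξ c).im + (ξ d).im)) ha0.le (by positivity) (by field_simp; ring)
    convert this using 1
    apply Complex.ext
    · simp only [wedge, Complex.add_re, Complex.re_ofReal_mul, Complex.ofReal_re,
        Complex.smul_re, smul_eq_mul]
      field_simp
      ring
    · simp only [Complex.add_im, Complex.im_ofReal_mul, Complex.ofReal_im, Complex.smul_im,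
        smul_eq_mul]
      field_simp
      ring
  obtain ⟨t, ht, hpt, ε, hε, hε'⟩ := T.exists_right hp hδ hpδ
  exact ⟨t, ht, (T.isEdge_of_mem hξ h ht ha0 ha1 hpt).left hξ hε hε'⟩

/-- Tiles with the same left vertex coincide. -/
theorem eq_of_left_vertex (T : RhombusTiling ξ) (hξ : IsZonogonFrame ξ) {t t' : Tile n}
    (ht : t ∈ T.tiles) (ht' : t' ∈ T.tiles) (h : t.base + ξ t.i = t'.base + ξ t'.i) : t = t' := by
  have left : ∀ t : Tile n, t.base + ξ t.i ∈ t.carrier ξ := fun t =>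
    ⟨1, 0, ⟨zero_le_one, le_rfl⟩, ⟨le_rfl, zero_le_one⟩, by simp⟩
  have shrink : ∀ (t : Tile n) (δ ε : ℝ), 0 < ε → ε ≤ δ → t.base + ξ t.i + (δ : ℂ) ∈ t.carrier ξ →
      t.base + ξ t.i + (ε : ℂ) ∈ t.carrier ξ := by
    intro t δ ε hε hεδ hm
    have hδ : 0 < δ := by linarith
    have := t.convex_carrier ξ (left t) hm (a := 1 - ε / δ) (b := ε / δ)
      (by rw [sub_nonneg, div_le_one hδ]; exact hεδ) (div_nonneg hε.le hδ.le) (by ring)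
    convert this using 1
    have hδ' : (δ : ℂ) ≠ 0 := by exact_mod_cast hδ.ne'
    simp only [Complex.real_smul]
    push_cast
    field_simp
    ring
  obtain ⟨δ, hδ, h1⟩ := t.exists_right_of_left_vertex hξ
  obtain ⟨δ', hδ', h2⟩ := t'.exists_right_of_left_vertex hξ
  refine T.eq_of_horizontal hξ ht ht' (lt_min hδ hδ') (left t) (h ▸ left t')
    (shrink t δ _ (lt_min hδ hδ') (min_le_left _ _) h1) ?_
  rw [h]
  exact shrink t' δ' _ (lt_min hδ hδ') (min_le_right _ _) h2

/-- The edges of the snake of `α` are edges of the tiling. -/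
def HasSnake (T : RhombusTiling ξ) (α : LinearOrderOn n) : Prop :=
  ∀ c, T.IsEdge (foot ξ α c) c

/-- `β` is obtained from `α` by a flip through a tile of the tiling. -/
def FlipIn (T : RhombusTiling ξ) (α β : LinearOrderOn n) : Prop :=
  ∃ i j, ∃ h : IsFlip α β i j, h.tile ξ ∈ T.tiles

/-- Some edge of a snake other than the right boundary is the lower left edge of a tile. -/
theorem exists_up_edge (T : RhombusTiling ξ) (hξ : IsZonogonFrame ξ) {α : LinearOrderOn n}
    (hα : T.HasSnake α) (hne : α ≠ (natural n).rev) :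
    ∃ c, ∃ t ∈ T.tiles, t.i = c ∧ t.base = foot ξ α c := by
  classical
  have hex : {c | ∃ d, c < d ∧ α.lt c d}.Nonempty := by
    by_contra hempty
    refine hne (le_antisymm (le_rev_natural α) (le_iff.2 fun i j hij _ => ?_))
    by_contra hlt
    exact hempty ⟨i, j, hij, (not_lt_iff hij.ne').1 hlt⟩
  -- The color c is the earliest one followed by a larger color, and d is the largest color after c.
  -- Then the colors before c are exactly those above d, so the foot of c is on the right boundary
  -- and can still be moved by ξ_d.
  obtain ⟨c, ⟨d₀, hd₀, hcd₀⟩, hmin⟩ := α.exists_first hex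
  obtain ⟨d, hd, hmax⟩ := Finset.exists_max_image
    (Finset.univ.filter fun d => α.lt c d) id ⟨d₀, by simp [hcd₀]⟩
  simp only [Finset.mem_filter, Finset.mem_univ, true_and, id] at hd hmax
  have hcd : c < d := hd₀.trans_le (hmax d₀ hcd₀)
  have low : ∀ x, α.lt x c ↔ d < x := by
    intro x
    constructor
    · intro hx
      by_contra! hxd
      rcases hxd.eq_or_lt with rfl | hxd
      · exact α.asymm hd hx
      · exact hmin x ⟨d, hxd, α.trans _ _ _ hx hd⟩ hx
    · intro hx
      by_contra hx'
      have hxc : x ≠ c := (hcd.trans hx).ne'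
      exact absurd (hmax x ((not_lt_iff hxc).1 hx')) (not_le_of_gt hx)
  have hfoot : ∀ b : ℝ, foot ξ α c + b * ξ d
      = ∑ x, ((if d < x then 1 else if x = d then b else 0 : ℝ) : ℂ) * ξ x := by
    intro b
    rw [foot_eq_sum, ← Finset.sum_ite_eq' Finset.univ d (fun x => (b : ℂ) * ξ x) |>.trans
      (if_pos (Finset.mem_univ d)), ← Finset.sum_add_distrib]
    refine Finset.sum_congr rfl fun x _ => ?_
    by_cases h1 : d < x
    · simp [low, h1, h1.ne']
    · by_cases h2 : x = d
      · simp [low, h2]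
      · simp [low, h1, h2]
  have hZ : foot ξ α c + ξ d ∈ zonogon ξ := by
    have := hfoot 1
    rw [Complex.ofReal_one, one_mul] at this
    refine ⟨_, fun x => ?_, this⟩
    split_ifs <;> simp
  obtain ⟨t, ht, ⟨h1, h2⟩ | ⟨-, h2⟩⟩ := T.exists_lower_left hξ (hα c) hcd hZ
  · exact ⟨c, t, ht, h1, h2⟩
  · exfalso
    obtain ⟨δ, hδ, hm⟩ := t.exists_right_of_left_vertex hξ
    rw [← h2] at hm
    obtain ⟨a, ha, e⟩ := T.subset_zonogon ht hm
    have key : wedge (foot ξ α c + (δ : ℂ)) (ξ d) ≤ wedge (foot ξ α c) (ξ d) := by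
      rw [e]
      have := hfoot 0
      rw [Complex.ofReal_zero, zero_mul, add_zero] at this
      rw [this, wedge_sum_mul, wedge_sum_mul]
      refine Finset.sum_le_sum fun x _ => ?_
      rcases lt_trichotomy x d with h | rfl | h
      · have hw : wedge (ξ x) (ξ d) < 0 := hξ.clockwise x d h
        rw [if_neg (lt_asymm h), if_neg h.ne, zero_mul]
        nlinarith [(ha x).1]
      · simp [wedge_self]
      · have hw : wedge (ξ d) (ξ x) < 0 := hξ.clockwise d x h
        rw [wedge_swap] at hw
        rw [if_pos h]
        nlinarith [(ha x).2]
    have := mul_pos hδ (hξ.upper d)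
    simp only [wedge, Complex.add_re, Complex.add_im, Complex.ofReal_re, Complex.ofReal_im] at key
    linarith

/-- A snake other than the right boundary can be flipped to the right. -/
theorem exists_flipIn (T : RhombusTiling ξ) (hξ : IsZonogonFrame ξ) {α : LinearOrderOn n}
    (hα : T.HasSnake α) (hne : α ≠ (natural n).rev) : ∃ β, T.FlipIn α β := by
  -- The last edge of the snake that is the lower left edge of a tile t is the one to flip: the next
  -- color d must be `t.j`.
  obtain ⟨c, ⟨t, ht, hti, htb⟩, hlast⟩ := α.rev.exists_first
    (S := {c | ∃ t ∈ T.tiles, t.i = c ∧ t.base = foot ξ α c}) (T.exists_up_edge hξ hα hne)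
  subst hti
  have hZ : foot ξ α t.i + ξ t.i + ξ t.j ∈ zonogon ξ :=
    T.subset_zonogon ht ⟨1, 1, ⟨zero_le_one, le_rfl⟩, ⟨zero_le_one, le_rfl⟩, by simp [htb]⟩
  have hex : ∃ x, α.lt t.i x := by
    by_contra hno
    rw [foot_add_of_last ξ (not_exists.1 hno)] at hZ
    have := (zonogon_im hξ hZ).2
    rw [Complex.add_im] at this
    linarith [hξ.upper t.j]
  obtain ⟨d, hd, hadj, hlow⟩ := exists_next hex
  have hfd : foot ξ α d = t.base + ξ t.i := by rw [foot_insert ξ hlow, htb]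
  have hle : d ≤ t.j := T.le_of_isEdge_left_vertex hξ ht (hfd ▸ hα d)
  rcases hle.eq_or_lt with rfl | hlt
  · obtain ⟨β, hβ⟩ := exists_isFlip t.hij hd hadj
    refine ⟨β, _, _, hβ, ?_⟩
    have : hβ.tile ξ = t := by
      unfold IsFlip.tile
      rw [← htb]
    rwa [this]
  -- If d < `t.j`, the edge of d has room to its right. It is then a lower left edge, against the
  -- choice of t, or the upper left edge of a tile with the same left vertex as t, hence of t
  -- itself.
  · exfalso
    obtain ⟨t', ht', ⟨h1, h2⟩ | ⟨h1, h2⟩⟩ := T.exists_lower_left hξ (hα d) hlt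
      (by rw [hfd, htb]; exact hZ)
    · exact hlast d ⟨t', ht', h1, h2⟩ hd
    · have := T.eq_of_left_vertex hξ ht ht' (by rw [← h2, hfd])
      subst this
      exact hlt.ne h1.symm

theorem HasSnake.flipIn {T : RhombusTiling ξ} {α β : LinearOrderOn n} (hα : T.HasSnake α)
    (h : T.FlipIn α β) : T.HasSnake β := by
  obtain ⟨i, j, h, ht⟩ := h
  intro c
  by_cases hi : c = i
  · subst hi
    exact ⟨_, ht, Or.inl ⟨rfl, Or.inr (h.foot_left' ξ)⟩⟩
  by_cases hj : c = j
  · subst hj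
    exact ⟨_, ht, Or.inr ⟨rfl, Or.inl (h.foot_right' ξ)⟩⟩
  · rw [← h.foot_of_ne ξ hi hj]
    exact hα c

/-- A snake can be moved to the right boundary by flips. -/
theorem HasSnake.reflTransGen {T : RhombusTiling ξ} (hξ : IsZonogonFrame ξ)
    {α : LinearOrderOn n} (hα : T.HasSnake α) :
    Relation.ReflTransGen T.FlipIn α (natural n).rev := by
  induction α using WellFoundedGT.induction with
  | _ α ih =>
    by_cases hne : α = (natural n).rev
    · rw [hne]
    · obtain ⟨β, hβ⟩ := T.exists_flipIn hξ hα hne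
      obtain ⟨i, j, h, -⟩ := id hβ
      exact Relation.ReflTransGen.head hβ (ih β h.lt' (hα.flipIn hβ))

end RhombusTiling

/-! ### The central symmetry, which turns flips to the right into flips to the left -/

/-- The image of a tile under the central symmetry of the zonogon. -/
noncomputable def Tile.rotate {n : ℕ} (ξ : Fin n → ℂ) (t : Tile n) : Tile n :=
  ⟨∑ x, ξ x - t.base - ξ t.i - ξ t.j, t.i, t.j, t.hij⟩

namespace Tile

variable {n : ℕ} {ξ : Fin n → ℂ} {t : Tile n}

theorem mem_rotate {z : ℂ} : z ∈ (t.rotate ξ).carrier ξ ↔ ∑ x, ξ x - z ∈ t.carrier ξ := by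
  constructor
  · rintro ⟨a, b, ⟨h1, h2⟩, ⟨h3, h4⟩, rfl⟩
    refine ⟨1 - a, 1 - b, ⟨by linarith, by linarith⟩, ⟨by linarith, by linarith⟩, ?_⟩
    simp only [rotate]
    push_cast
    ring
  · rintro ⟨a, b, ⟨h1, h2⟩, ⟨h3, h4⟩, e⟩
    refine ⟨1 - a, 1 - b, ⟨by linarith, by linarith⟩, ⟨by linarith, by linarith⟩, ?_⟩
    simp only [rotate]
    push_cast
    linear_combination -e

theorem rotate_rotate (ξ : Fin n → ℂ) (t : Tile n) : (t.rotate ξ).rotate ξ = t := by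
  cases t
  simp only [rotate, Tile.mk.injEq, and_self, and_true]
  ring

theorem IsVertex.rotate {v : ℂ} (h : t.IsVertex ξ v) :
    (t.rotate ξ).IsVertex ξ (∑ x, ξ x - v) := by
  rcases h with rfl | rfl | rfl | rfl
  · exact Or.inr (Or.inr (Or.inr (by simp only [Tile.rotate]; ring)))
  · exact Or.inr (Or.inr (Or.inl (by simp only [Tile.rotate]; ring)))
  · exact Or.inr (Or.inl (by simp only [Tile.rotate]; ring))
  · exact Or.inl (by simp only [Tile.rotate]; ring)

theorem IsEdge.rotate {v : ℂ} {c : Fin n} (h : t.IsEdge ξ v c) :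
    (t.rotate ξ).IsEdge ξ (∑ x, ξ x - v - ξ c) c := by
  rcases h with ⟨rfl, rfl | rfl⟩ | ⟨rfl, rfl | rfl⟩
  · exact Or.inl ⟨rfl, Or.inr (by simp only [Tile.rotate]; ring)⟩
  · exact Or.inl ⟨rfl, Or.inl (by simp only [Tile.rotate]; ring)⟩
  · exact Or.inr ⟨rfl, Or.inr (by simp only [Tile.rotate]; ring)⟩
  · exact Or.inr ⟨rfl, Or.inl (by simp only [Tile.rotate]; ring)⟩

end Tile

theorem sub_mem_zonogon {n : ℕ} {ξ : Fin n → ℂ} {z : ℂ} (hz : z ∈ zonogon ξ) :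
    ∑ x, ξ x - z ∈ zonogon ξ := by
  obtain ⟨a, ha, rfl⟩ := hz
  refine ⟨fun i => 1 - a i, fun i => ⟨by linarith [(ha i).2], by linarith [(ha i).1]⟩, ?_⟩
  rw [← Finset.sum_sub_distrib]
  refine Finset.sum_congr rfl fun i _ => ?_
  push_cast
  ring

namespace RhombusTiling

variable {n : ℕ} {ξ : Fin n → ℂ}

open Classical in
/-- The image of a tiling under the central symmetry of the zonogon. -/
noncomputable def rotate (T : RhombusTiling ξ) : RhombusTiling ξ where
  tiles := T.tiles.image (Tile.rotate ξ)
  cover := by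
    ext z
    simp only [Set.mem_iUnion, Finset.mem_image, exists_prop]
    constructor
    · rintro ⟨_, ⟨t, ht, rfl⟩, hz⟩
      have := sub_mem_zonogon (T.subset_zonogon ht (Tile.mem_rotate.1 hz))
      rwa [sub_sub_cancel] at this
    · intro hz
      have := sub_mem_zonogon hz
      rw [← T.cover] at this
      obtain ⟨t, ht, hzt⟩ := Set.mem_iUnion₂.1 this
      exact ⟨_, ⟨t, ht, rfl⟩, Tile.mem_rotate.2 hzt⟩
  inter := by
    intro _ hr _ hr' hne hnon
    obtain ⟨t, ht, rfl⟩ := Finset.mem_image.1 hr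
    obtain ⟨t', ht', rfl⟩ := Finset.mem_image.1 hr'
    obtain ⟨z, hz⟩ := hnon
    have hI : (t.rotate ξ).carrier ξ ∩ (t'.rotate ξ).carrier ξ
        = {z | ∑ x, ξ x - z ∈ t.carrier ξ ∩ t'.carrier ξ} := by
      ext z
      exact and_congr Tile.mem_rotate Tile.mem_rotate
    rcases T.inter t ht t' ht' (fun e => hne (e ▸ rfl))
      ⟨_, Tile.mem_rotate.1 hz.1, Tile.mem_rotate.1 hz.2⟩ with ⟨v, h1, h2, h3⟩ | ⟨v, c, h1, h2, h3⟩
    · refine Or.inl ⟨_, h1.rotate, h2.rotate, ?_⟩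
      rw [hI, h3]
      ext z
      simp only [Set.mem_singleton_iff, Set.mem_ofPred_eq]
      constructor <;> intro e <;> linear_combination -e
    · refine Or.inr ⟨_, c, h1.rotate, h2.rotate, ?_⟩
      rw [hI, h3]
      ext z
      simp only [Set.mem_ofPred_eq, mem_segment_add]
      constructor
      · rintro ⟨a, h0, h1, e⟩
        refine ⟨1 - a, by linarith, by linarith, ?_⟩
        push_cast
        linear_combination -e
      · rintro ⟨a, h0, h1, e⟩
        refine ⟨1 - a, by linarith, by linarith, ?_⟩
        push_cast
        linear_combination -e

theorem HasSnake.rotate {T : RhombusTiling ξ} {α : LinearOrderOn n} (hα : T.HasSnake α) :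
    T.rotate.HasSnake α.rev := by
  classical
  intro c
  obtain ⟨t, ht, he⟩ := hα c
  refine ⟨_, Finset.mem_image_of_mem _ ht, ?_⟩
  have : foot ξ α.rev c = ∑ x, ξ x - foot ξ α c - ξ c := by
    rw [← foot_rev_add ξ α c]
    ring
  rw [this]
  exact he.rotate

theorem FlipIn.rev {T : RhombusTiling ξ} {α β : LinearOrderOn n} (h : T.rotate.FlipIn α β) :
    T.FlipIn β.rev α.rev := by
  classical
  obtain ⟨i, j, h, ht⟩ := h
  obtain ⟨t, ht, e⟩ := Finset.mem_image.1 ht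
  refine ⟨i, j, h.rev, ?_⟩
  have : h.rev.tile ξ = t := by
    rw [← t.rotate_rotate ξ, e]
    simp only [Tile.rotate, IsFlip.tile, Tile.mk.injEq, and_self, and_true]
    rw [← foot_rev_add ξ β i, h.foot_left']
    ring
  rwa [this]

/-- A snake is obtained from the left boundary by flips. -/
theorem HasSnake.reflTransGen_left {T : RhombusTiling ξ} (hξ : IsZonogonFrame ξ)
    {α : LinearOrderOn n} (hα : T.HasSnake α) :
    Relation.ReflTransGen T.FlipIn (natural n) α := by
  have h := hα.rotate.reflTransGen hξ
  have : ∀ β γ, Relation.ReflTransGen T.rotate.FlipIn β γ →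
      Relation.ReflTransGen T.FlipIn γ.rev β.rev := by
    intro β γ h
    induction h with
    | refl => exact Relation.ReflTransGen.refl
    | tail _ h ih => exact Relation.ReflTransGen.head h.rev ih
  exact this _ _ h

end RhombusTiling

/-! ### Words of linear orders and directed paths -/

namespace LinearOrderOn

variable {n : ℕ} {ξ : Fin n → ℂ}

theorem foot_eq_list_sum (ξ : Fin n → ℂ) {σ : LinearOrderOn n} {l₁ l₂ : List (Fin n)} {c : Fin n}
    (hl : (l₁ ++ c :: l₂).Pairwise σ.lt) (hmem : ∀ i, i ∈ l₁ ++ c :: l₂) :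
    foot ξ σ c = (l₁.map ξ).sum := by
  classical
  obtain ⟨h1, h2, h3⟩ := List.pairwise_append.1 hl
  obtain ⟨h4, -⟩ := List.pairwise_cons.1 h2
  have hnd : l₁.Nodup := h1.imp fun h => ne_of_lt h
  have key : ∀ x, σ.lt x c ↔ x ∈ l₁ := by
    intro x
    constructor
    · intro hx
      rcases List.mem_append.1 (hmem x) with h | h
      · exact h
      rcases List.mem_cons.1 h with rfl | h
      · exact absurd hx (σ.irrefl _)
      · exact absurd hx (σ.asymm (h4 x h))
    · exact fun hx => h3 x hx c List.mem_cons_self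
  rw [← List.sum_toFinset ξ hnd]
  unfold foot
  rw [← Finset.sum_filter]
  refine Finset.sum_congr ?_ fun _ _ => rfl
  ext x
  simp [key]

/-- The word of a linear order. -/
theorem exists_word (σ : LinearOrderOn n) :
    ∃ l : List (Fin n), l.Pairwise σ.lt ∧ ∀ i, i ∈ l := by
  classical
  let r : Fin n → Fin n → Prop := fun a b => a = b ∨ σ.lt a b
  have : Std.Total r := ⟨fun a b => by
    by_cases h : a = b
    · exact Or.inl (Or.inl h)
    · exact (σ.total a b h).imp Or.inr Or.inr⟩
  have : IsTrans (Fin n) r := ⟨by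
    rintro a b c (rfl | h1) (rfl | h2)
    exacts [Or.inl rfl, Or.inr h2, Or.inr h1, Or.inr (σ.trans _ _ _ h1 h2)]⟩
  have hperm := List.perm_insertionSort r (List.finRange n)
  refine ⟨List.insertionSort r (List.finRange n), ?_,
    fun i => hperm.mem_iff.2 (List.mem_finRange i)⟩
  have h1 := List.pairwise_insertionSort r (List.finRange n)
  have h2 : (List.insertionSort r (List.finRange n)).Nodup :=
    hperm.nodup_iff.2 (List.nodup_finRange n)
  exact h1.imp₂ (fun a b h3 h4 => h3.resolve_left h4) h2

end LinearOrderOn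

namespace RhombusTiling

variable {n : ℕ} {ξ : Fin n → ℂ}

theorem IsPath.isEdge {T : RhombusTiling ξ} {l₁ l₂ : List (Fin n)} {c : Fin n} {u v : ℂ}
    (h : T.IsPath u (l₁ ++ c :: l₂) v) : T.IsEdge (u + (l₁.map ξ).sum) c := by
  induction l₁ generalizing u with
  | nil => simpa using h.1
  | cons d l ih =>
    have := ih h.2
    rwa [List.map_cons, List.sum_cons, ← add_assoc]

theorem HasSnake.isPath {T : RhombusTiling ξ} {σ : LinearOrderOn n} (h : T.HasSnake σ)
    (l₁ l₂ : List (Fin n)) (hl : (l₁ ++ l₂).Pairwise σ.lt) (hmem : ∀ i, i ∈ l₁ ++ l₂) :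
    T.IsPath (l₁.map ξ).sum l₂ (∑ i, ξ i) := by
  classical
  induction l₂ generalizing l₁ with
  | nil =>
    rw [List.append_nil] at hl hmem
    have hnd : l₁.Nodup := hl.imp fun h => LinearOrderOn.ne_of_lt h
    change (l₁.map ξ).sum = _
    rw [← List.sum_toFinset ξ hnd]
    refine Finset.sum_congr ?_ fun _ _ => rfl
    ext x
    simp [hmem]
  | cons c l ih =>
    refine ⟨foot_eq_list_sum ξ hl hmem ▸ h c, ?_⟩
    have := ih (l₁ ++ [c]) (by simpa using hl) (by simpa using hmem)
    simpa using this

/-- A path from 0 with the word of σ has traversed exactly the colors below c when it reaches c, so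
its edges start at the feet. This replaces paths by a separate condition on each color. -/
theorem mem_compatible_iff {T : RhombusTiling ξ} {σ : LinearOrderOn n} :
    σ ∈ T.compatible ↔ T.HasSnake σ := by
  constructor
  · rintro ⟨l, hl, hp, hm⟩ c
    obtain ⟨l₁, l₂, rfl⟩ := List.append_of_mem (hm c)
    have := hl.isEdge
    rwa [zero_add, ← foot_eq_list_sum ξ hp hm] at this
  · intro h
    obtain ⟨l, hl, hm⟩ := σ.exists_word
    exact ⟨l, h.isPath [] l hl hm, hl, hm⟩

/-! ### Orders occurring in one tiling are not opposed -/

/-- Each tile of a tiling is flipped either before or after a given snake. -/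
theorem HasSnake.exists_isFlip {T : RhombusTiling ξ} (hξ : IsZonogonFrame ξ) (hn : 2 ≤ n)
    {σ : LinearOrderOn n} (hσ : T.HasSnake σ) {t : Tile n} (ht : t ∈ T.tiles) :
    ∃ α β, IsFlip α β t.i t.j ∧ t.base = foot ξ α t.i ∧ (β ≤ σ ∨ σ ≤ α) := by
  obtain ⟨c₁, N₁, h1, h2, h3⟩ := (hσ.reflTransGen hξ).exists_seq
    (fun _ => (natural n).rev) 0 rfl fun s hs => absurd hs (Nat.not_lt_zero s)
  obtain ⟨c, m, h4, h5, h6⟩ := (hσ.reflTransGen_left hξ).exists_seq c₁ (0 + N₁) h1 h3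
  have hc : IsSweep c (0 + N₁ + m) := by
    refine ⟨h4, by rw [h5, h2], fun s hs => ?_⟩
    obtain ⟨i, j, h, -⟩ := h6 s hs
    exact ⟨i, j, h⟩
  have mono : ∀ s r, s ≤ r → r ≤ 0 + N₁ + m → c s ≤ c r := by
    intro s r hsr
    induction r, hsr using Nat.le_induction with
    | base => exact fun _ => le_rfl
    | succ r hsr ih =>
      intro hr
      obtain ⟨i, j, h⟩ := hc.step r hr
      exact (ih (Nat.le_of_succ_le hr)).trans h.le
  have hm : c m = σ := by rw [← h1, ← h5, zero_add]
  have hcenter : t.base + ((1 / 2 : ℝ) : ℂ) * ξ t.i + ((1 / 2 : ℝ) : ℂ) * ξ t.j ∈ zonogon ξ :=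
    T.subset_zonogon ht ⟨1 / 2, 1 / 2, by norm_num, by norm_num, rfl⟩
  -- The flips through σ form a sweep, so the tiles they use already cover the zonogon. The one
  -- covering the center of t must be t, and its time s is compared with the time m of σ.
  obtain ⟨t', ⟨s, hs, i, j, h, rfl⟩, hmem⟩ := hc.exists_mem hξ hn hcenter
  have hT : h.tile ξ ∈ T.tiles := by
    obtain ⟨k, l, h', hT⟩ := h6 s hs
    obtain ⟨rfl, rfl⟩ := h.unique h'
    exact hT
  have e := T.eq_of_center_mem hξ ht hT hmem
  subst e
  refine ⟨c s, c (s + 1), h, rfl, ?_⟩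
  rw [← hm]
  rcases le_or_gt m s with hms | hms
  · exact Or.inr (mono m s hms hs.le)
  · exact Or.inl (mono (s + 1) m hms (by omega))

/-- Some step reverses the pair, and a flip reverses only the two colors of its own tile. -/
theorem exists_tile_of_reflTransGen {T : RhombusTiling ξ} {α β : LinearOrderOn n}
    (h : Relation.ReflTransGen T.FlipIn α β) {i j : Fin n} (hα : α.lt i j) (hβ : β.lt j i) :
    ∃ t ∈ T.tiles, t.i = i ∧ t.j = j ∨ t.i = j ∧ t.j = i := by
  induction h using Relation.ReflTransGen.head_induction_on with
  | refl => exact absurd hα (β.asymm hβ)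
  | @head α γ h1 _ ih =>
    by_cases hγ : γ.lt i j
    · exact ih hγ
    obtain ⟨k, l, hf, ht⟩ := h1
    by_contra hno
    refine hγ ((hf.agree i j ?_ ?_).1 hα)
    · rintro rfl rfl
      exact hno ⟨_, ht, Or.inl ⟨rfl, rfl⟩⟩
    · rintro rfl rfl
      exact hno ⟨_, ht, Or.inr ⟨rfl, rfl⟩⟩

/-- A tiling with a snake has tiles of all pairs of colors. -/
theorem HasSnake.exists_tile {T : RhombusTiling ξ} (hξ : IsZonogonFrame ξ)
    {σ : LinearOrderOn n} (hσ : T.HasSnake σ) {i j : Fin n} (hij : i < j) :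
    ∃ t ∈ T.tiles, t.i = i ∧ t.j = j := by
  obtain ⟨t, ht, h | h⟩ := exists_tile_of_reflTransGen
    ((hσ.reflTransGen_left hξ).trans (hσ.reflTransGen hξ)) (i := i) (j := j) hij hij
  · exact ⟨t, ht, h⟩
  · have := t.hij
    rw [h.1, h.2] at this
    exact absurd this (lt_asymm hij)

end RhombusTiling

namespace LinearOrderOn

variable {n : ℕ} {ξ : Fin n → ℂ}

/-- The edge of color `j` moves to the right as the order increases. -/
theorem wedge_foot_mono (hξ : IsZonogonFrame ξ) {α β : LinearOrderOn n} (h : α ≤ β) (j : Fin n) :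
    wedge (foot ξ α j) (ξ j) ≤ wedge (foot ξ β j) (ξ j) := by
  classical
  rw [foot_eq_sum, foot_eq_sum, wedge_sum_mul, wedge_sum_mul]
  rw [le_iff] at h
  -- As the order grows, the lower set of j can only lose smaller colors, of negative determinant
  -- against ξ_j, and gain larger ones, of positive determinant.
  refine Finset.sum_le_sum fun x _ => ?_
  rcases lt_trichotomy x j with hx | rfl | hx
  · have hw : wedge (ξ x) (ξ j) < 0 := hξ.clockwise x j hx
    by_cases h1 : β.lt x j
    · have h2 : α.lt x j := by
        by_contra hc
        exact β.asymm h1 (h x j hx ((not_lt_iff hx.ne).1 hc))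
      simp [h1, h2]
    · simp only [h1, if_false, zero_mul]
      split_ifs <;> linarith
  · simp [wedge_self]
  · have hw : wedge (ξ j) (ξ x) < 0 := hξ.clockwise j x hx
    rw [wedge_swap] at hw
    by_cases h1 : α.lt x j
    · simp [h1, h j x hx h1]
    · simp only [h1, if_false, zero_mul]
      split_ifs <;> linarith

end LinearOrderOn

namespace RhombusTiling

variable {n : ℕ} {ξ : Fin n → ℂ}

/-- Let A be an ij-tile and B a jk-tile. Passing from A through σ to B carries the edge of color j
from the right side of A to the left side of B (`le1`); passing from B through τ to A carries it
from the right side of B to the left side of A (`le2`). Adding the two gives `wedge (ξ k) (ξ j)` ≤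
`wedge (ξ i) (ξ j)`, a positive number below a negative one. -/
theorem HasSnake.not_opposed {T : RhombusTiling ξ} (hξ : IsZonogonFrame ξ) (hn : 2 ≤ n)
    {σ τ : LinearOrderOn n} (hσ : T.HasSnake σ) (hτ : T.HasSnake τ) : ¬ Opposed σ τ := by
  rintro ⟨i, j, k, hij, hjk, ⟨s1, s2⟩, t1, t2⟩
  obtain ⟨A, hA, rfl, rfl⟩ := hσ.exists_tile hξ hij
  obtain ⟨B, hB, hBi, rfl⟩ := hσ.exists_tile hξ hjk
  have le1 : wedge A.base (ξ A.j) ≤ wedge B.base (ξ A.j) := by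
    obtain ⟨α, β, h, hb, hcmp⟩ := hσ.exists_isFlip hξ hn hA
    obtain ⟨α', β', h', hb', hcmp'⟩ := hσ.exists_isFlip hξ hn hB
    rw [hBi] at h' hb'
    have c1 : β ≤ σ := hcmp.resolve_right fun e => α.asymm h.left (le_iff.1 e _ _ hij s1)
    have c2 : σ ≤ α' := hcmp'.resolve_left fun e => σ.asymm s2 (le_iff.1 e _ _ hjk h'.right)
    have := wedge_foot_mono hξ (c1.trans c2) A.j
    rwa [h.foot_right', ← hb, ← hb'] at this
  have le2 : wedge (B.base + ξ B.j) (ξ A.j) ≤ wedge (A.base + ξ A.i) (ξ A.j) := by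
    obtain ⟨α, β, h, hb, hcmp⟩ := hτ.exists_isFlip hξ hn hA
    obtain ⟨α', β', h', hb', hcmp'⟩ := hτ.exists_isFlip hξ hn hB
    rw [hBi] at h' hb'
    have c1 : τ ≤ α := hcmp.resolve_left fun e => τ.asymm t1 (le_iff.1 e _ _ hij h.right)
    have c2 : β' ≤ τ := hcmp'.resolve_right fun e => α'.asymm h'.left (le_iff.1 e _ _ hjk t2)
    have := wedge_foot_mono hξ (c2.trans c1) A.j
    rwa [h.foot_right, h'.foot_left', ← hb, ← hb'] at this
  have w1 : wedge (ξ A.i) (ξ A.j) < 0 := hξ.clockwise _ _ hij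
  have w2 : wedge (ξ A.j) (ξ B.j) < 0 := hξ.clockwise _ _ hjk
  simp only [wedge, Complex.add_re, Complex.add_im] at le1 le2 w1 w2
  linarith

end RhombusTiling

theorem StronglyConsistent.peakPit {n : ℕ} (hn : 2 ≤ n) {ξ : Fin n → ℂ} (hξ : IsZonogonFrame ξ)
    {σ τ : LinearOrderOn n} (h : StronglyConsistent ξ σ τ) : PeakPit σ τ := by
  obtain ⟨T, hσ, hτ⟩ := h
  rw [RhombusTiling.mem_compatible_iff] at hσ hτ
  exact peakPit_iff.2 ⟨hσ.not_opposed hξ hn hτ, hτ.not_opposed hξ hn hσ⟩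

/-! ### A common tiling, and the equivalence -/

/-- Locally nested orders occur in the tiling of a sweep through their meet and their join. -/
theorem LinearOrderOn.LocallyNested.stronglyConsistent {n : ℕ} (hn : 2 ≤ n) {ξ : Fin n → ℂ}
    (hξ : IsZonogonFrame ξ) {σ τ : LinearOrderOn n} (h : LocallyNested σ τ) :
    StronglyConsistent ξ σ τ := by
  -- The sweep is assembled from its end: join to top, then meet to join, then bottom to meet. Each
  -- extension shifts the earlier indices, so the meet sits at time N and the join at N₂ + N.
  obtain ⟨c₁, N₁, a1, b1, s1⟩ := (reflTransGen_isFlip (le_rev_natural (σ ⊔ τ))).exists_seq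
    (fun _ => (natural n).rev) 0 rfl fun s hs => absurd hs (Nat.not_lt_zero s)
  obtain ⟨c₂, N₂, a2, b2, s2⟩ := (reflTransGen_isFlip (inf_le_sup : σ ⊓ τ ≤ σ ⊔ τ)).exists_seq
    c₁ _ a1 s1
  obtain ⟨c, N, a3, b3, s3⟩ := (reflTransGen_isFlip (natural_le (σ ⊓ τ))).exists_seq c₂ _ a2 s2
  have hc : IsSweep c (0 + N₁ + N₂ + N) := ⟨a3, by rw [b3, b2, b1], s3⟩
  have hinf : c N = σ ⊓ τ := by rw [← a2, ← b3, zero_add]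
  have hsup : c (N₂ + N) = σ ⊔ τ := by rw [b3, ← a1, ← b2, zero_add]
  have edge : ∀ m ≤ 0 + N₁ + N₂ + N, (hc.tiling hξ hn).HasSnake (c m) := by
    intro m hm d
    obtain ⟨t, ht, he⟩ := hc.exists_isEdge hn ξ hm d
    exact ⟨t, (Swept.finite ξ c _).mem_toFinset.2 ht, he⟩
  have e1 := edge N (by omega)
  have e2 := edge (N₂ + N) (by omega)
  rw [hinf] at e1
  rw [hsup] at e2
  refine ⟨hc.tiling hξ hn, ?_, ?_⟩ <;> rw [RhombusTiling.mem_compatible_iff] <;> intro d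
  · rcases h.lower_eq d with hl | hl <;> rw [foot_congr ξ hl]
    exacts [e2 d, e1 d]
  · have hl := h.symm.lower_eq d
    rw [sup_comm, inf_comm] at hl
    rcases hl with hl | hl <;> rw [foot_congr ξ hl]
    exacts [e2 d, e1 d]

theorem proposition3 {n : ℕ} (hn : 2 ≤ n) (ξ : Fin n → ℂ) (hξ : IsZonogonFrame ξ)
    (σ τ : LinearOrderOn n) :
    List.TFAE [
      StronglyConsistent ξ σ τ,
      SeparatedSystem (σ.Id ∪ τ.Id),
      ∀ i j k : Fin n, i < j → j < k →
        (σ.Peak i j k ∧ τ.Peak i j k) ∨ (σ.Pit i j k ∧ τ.Pit i j k),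
      σ.Id ∪ τ.Id = (σ ⊔ τ).Id ∪ (σ ⊓ τ).Id,
      σ.Id ∪ τ.Id ⊆ (σ ⊔ τ).Id ∪ (σ ⊓ τ).Id] := by
  tfae_have 1 → 3 := fun h => h.peakPit hn hξ
  tfae_have 2 ↔ 3 := separatedSystem_iff_peakPit
  tfae_have 3 → 1 := fun h => (PeakPit.locallyNested h).stronglyConsistent hn hξ
  tfae_have 3 → 4 := fun h => (PeakPit.locallyNested h).Id_union_eq
  tfae_have 4 → 5 := fun h => h.subset
  tfae_have 5 → 3 := by
    intro h
    refine peakPit_iff.2 ⟨not_opposed_of_Id_subset (Set.subset_union_left.trans h),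
      not_opposed_of_Id_subset ?_⟩
    rw [sup_comm, inf_comm]
    exact Set.subset_union_right.trans h
  tfae_finish
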